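/- \textbf{Theorem B (Duality).} Let $\mathbb{F}=\mathbb{Q}(q,t)$ and $\mathbb{K}=\mathbb{Q}(q,t,a)$, let $n$ be a positive integer, $x=(x_1,\dots,x_n)$, and let $\mathcal{C}_n=(\mathbb{Z}_{\ge 0})^n$ be the set of compositions. For $v\in\mathbb{Z}^n$ put $|v|=v_1+\cdots+v_n$ and let $\overline{v}\in\mathbb{F}^n$ be the vector with entries $$\overline{v}_i=q^{v_i}t^{-k_i(v)},\qquad k_i(v)=\#\{k<i\mid v_k\ge v_i\}+\#\{k>i\mid v_k>v_i\}.$$ Put $\widetilde{v}=\overline{(-v_n,\dots,-v_1)}$ and $\tau=\overline{0}=(1,t^{-1},\dots,t^{1-n})$. Write $(y;q)_m=\prod_{j=0}^{m-1}(1-q^jy)$ and $(m^n)=(m,\dots,m)$. (1) For each $\alpha\in\mathcal{C}_n$ there is exactly one polynomial $G_\alpha\in\mathbb{F}[x]$ of total degree at most $|\alpha|$ such that $G_\alpha(\overline{\beta})=0$ for all $\beta\in\mathcal{C}_n$ with $|\beta|\le|\alpha|$ and $\beta\ne\alpha$, and such that the coefficient of $x^\alpha$ in $G_\alpha$ is $1$.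 Put $K_\alpha(x)=G_\alpha(x)/G_\alpha(a\tau)\in\mathbb{K}[x]$. (2) For each $v\in\mathbb{Z}^n$ the rational functions $G_v\in\mathbb{F}(x)$ and $K_v\in\mathbb{K}(x)$ given by $$G_v(x)=q^{-m|v|-m^2n}\,\frac{G_{v+(m^n)}(q^mx)}{\prod_{i=1}^n x_i^m\,\bigl(q^{-m}t^{1-n}x_i^{-1};q\bigr)_m},\qquad K_v(x)=\Bigl(\prod_{i=1}^n\frac{\bigl(q^{1-m}a\overline{v}_i^{-1};q\bigr)_m}{\bigl(qt^{n-1}x_i;q\bigr)_m}\Bigr)K_{v+(m^n)}(q^mx)$$ do not depend on the choice of the integer $m\ge 0$ with $v+(m^n)\in\mathcal{C}_n$. (3) For each $v\in\mathbb{Z}^n$, $G_v$ is regular at $a\tau$, $G_v(a\tau)\neq 0$, and $K_v(x)=G_v(x)/G_v(a\tau)$. (4) (Duality) For all $u,v\in\mathbb{Z}^n$, $K_u$ is regular at $a\widetilde{v}$, $K_v$ is regular at $a\widetilde{u}$, and $$K_u(a\widetilde{v})=K_v(a\widetilde{u}).$$ This is the non-symmetric analogue of Okounkov's evaluation symmetry.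 -/

import Mathlib

noncomputable section

namespace InterpMac

open MvPolynomial

/-! ### The base fields -/

/-- The field `𝔽 = ℚ(q, t)`. -/
abbrev BaseF : Type := FractionRing (MvPolynomial (Fin 2) ℚ)

/-- The indeterminate `q` in `𝔽`. -/
def qF : BaseF := algebraMap (MvPolynomial (Fin 2) ℚ) BaseF (X 0)

/-- The indeterminate `t` in `𝔽`. -/
def tF : BaseF := algebraMap (MvPolynomial (Fin 2) ℚ) BaseF (X 1)

/-- The field `𝕂 = 𝔽(a) = ℚ(q, t, a)`. -/
abbrev BaseK : Type := RatFunc BaseF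

/-- The inclusion of `𝔽` into `𝕂`. -/
def inclFK : BaseF →+* BaseK := RatFunc.C

/-- `q` as an element of `𝕂`. -/
def qK : BaseK := inclFK qF

/-- `t` as an element of `𝕂`. -/
def tK : BaseK := inclFK tF

/-- The indeterminate `a` in `𝕂`. -/
def aK : BaseK := RatFunc.X

/-! ### Spectral vectors -/

/-- `k_i(v) = #{k < i | v_k ≥ v_i} + #{k > i | v_k > v_i}`. -/
def kIndex {n : ℕ} (v : Fin n → ℤ) (i : Fin n) : ℕ :=
  (Finset.univ.filter fun k : Fin n => k < i ∧ v i ≤ v k).card +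
    (Finset.univ.filter fun k : Fin n => i < k ∧ v i < v k).card

/-- The spectral vector `v̄`, with entries `q ^ v_i * t ^ (-k_i(v))`. -/
def bar {k : Type*} [Field k] (q t : k) {n : ℕ} (v : Fin n → ℤ) : Fin n → k :=
  fun i => q ^ (v i) * t ^ (-(kIndex v i : ℤ))

/-- The vector `ṽ`, which is the spectral vector of `-w₀ v = (-v_n, …, -v_1)`. -/
def tilde {k : Type*} [Field k] (q t : k) {n : ℕ} (v : Fin n → ℤ) : Fin n → k :=
  bar q t fun i => -v i.rev

/-- `τ = (1, t⁻¹, …, t ^ (1 - n))`; the index `i` runs from `0` to `n - 1`. -/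
def tau {k : Type*} [Field k] (t : k) (n : ℕ) : Fin n → k :=
  fun i => t ^ (-((i : ℕ) : ℤ))

/-! ### Interpolation polynomials for compositions -/

/-- The defining properties of the non-symmetric interpolation Macdonald polynomial of the
composition `α`: degree at most `|α|`, vanishing at `β̄` for all compositions `β ≠ α` with
`|β| ≤ |α|`, and coefficient `1` at `x ^ α`. -/
def IsInterp {k : Type*} [Field k] (q t : k) {n : ℕ} (α : Fin n → ℕ)
    (P : MvPolynomial (Fin n) k) : Prop :=
  P.totalDegree ≤ ∑ i, α i ∧
    (∀ β : Fin n → ℕ, ∑ i, β i ≤ ∑ i, α i → β ≠ α →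
      eval (bar q t fun i => (β i : ℤ)) P = 0) ∧
    coeff (Finsupp.equivFunOnFinite.symm α) P = 1

open Classical in
/-- `G_α(x; q, t) ∈ 𝔽[x]` for a composition `α`: the polynomial with the defining properties
(default value `0` if there were none). -/
def polyG {n : ℕ} (α : Fin n → ℕ) : MvPolynomial (Fin n) BaseF :=
  if h : ∃ P, IsInterp qF tF α P then h.choose else 0

/-- `K_α(x; q, t; a) = G_α(x) / G_α(a τ) ∈ 𝕂[x]` for a composition `α`. -/
def polyK {n : ℕ} (α : Fin n → ℕ) : MvPolynomial (Fin n) BaseK :=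
  C (eval (fun i => aK * tau tK n i) (map inclFK (polyG α)))⁻¹ * map inclFK (polyG α)

/-! ### Rational functions and their values -/

/-- The field `k(x) = k(x_1, …, x_n)` of rational functions. -/
abbrev RatFun (n : ℕ) (k : Type*) [Field k] : Type _ := FractionRing (MvPolynomial (Fin n) k)

/-- A polynomial as a rational function. -/
def ofPoly {n : ℕ} {k : Type*} [Field k] : MvPolynomial (Fin n) k →+* RatFun n k :=
  algebraMap (MvPolynomial (Fin n) k) (RatFun n k)

/-- The inclusion of `𝔽(x)` into `𝕂(x)`. -/
def inclRat (n : ℕ) : RatFun n BaseF →+* RatFun n BaseK :=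
  IsFractionRing.lift (A := MvPolynomial (Fin n) BaseF)
    (g := (ofPoly (n := n) (k := BaseK)).comp (map inclFK))
    ((IsFractionRing.injective (MvPolynomial (Fin n) BaseK) (RatFun n BaseK)).comp
      (map_injective inclFK inclFK.injective))

/-- The rational function `f` is regular at the point `y` and has the value `c` there: `f` can be
written as a quotient `p / d` of polynomials with `d(y) ≠ 0` and `p(y) / d(y) = c`. -/
def HasValueAt {n : ℕ} {k : Type*} [Field k] (f : RatFun n k) (y : Fin n → k) (c : k) : Prop :=
  ∃ p d : MvPolynomial (Fin n) k, eval y d ≠ 0 ∧ f = ofPoly p / ofPoly d ∧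
    c = eval y p / eval y d

/-- The value of a rational function at a point is unique. -/
theorem HasValueAt.unique {n : ℕ} {k : Type*} [Field k] {f : RatFun n k} {y : Fin n → k}
    {c c' : k} (h : HasValueAt f y c) (h' : HasValueAt f y c') : c = c' := by
  obtain ⟨p, d, hd, hf, rfl⟩ := h
  obtain ⟨p', d', hd', hf', rfl⟩ := h'
  have inj : Function.Injective (ofPoly (n := n) (k := k)) :=
    IsFractionRing.injective (MvPolynomial (Fin n) k) (RatFun n k)
  have ne : ∀ e : MvPolynomial (Fin n) k, eval y e ≠ 0 → ofPoly e ≠ 0 := by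
    intro e he h0
    apply he
    rw [(map_eq_zero_iff ofPoly inj).mp h0, map_zero]
  rw [hf, div_eq_div_iff (ne d hd) (ne d' hd'), ← map_mul, ← map_mul] at hf'
  rw [div_eq_div_iff hd hd', ← map_mul, ← map_mul, inj hf']

/-! ### Extension to integral vectors -/

/-- The polynomial `P(c x)`. -/
def dilate {n : ℕ} {k : Type*} [Field k] (c : k) (P : MvPolynomial (Fin n) k) :
    MvPolynomial (Fin n) k :=
  bind₁ (fun i => C c * X i) P

/-- The `q`-shifted factorial `(y; q)_m = ∏_{j < m} (1 - q ^ j y)`. -/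
def qPoch {k : Type*} [Field k] (q y : k) (m : ℕ) : k :=
  ∏ j ∈ Finset.range m, (1 - q ^ j * y)

/-- `v + (m ^ n)`, as a composition (used only if all entries of `v + (m ^ n)` are nonnegative). -/
def shiftComp {n : ℕ} (m : ℕ) (v : Fin n → ℤ) : Fin n → ℕ :=
  fun i => (v i + m).toNat

/-- The rational function
`q ^ (-m|v| - m² n) * G_{v + (m ^ n)}(q ^ m x) / ∏_i x_i ^ m (q ^ (-m) t ^ (1 - n) x_i⁻¹; q)_m`. -/
def shiftG {n : ℕ} (m : ℕ) (v : Fin n → ℤ) : RatFun n BaseF :=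
  ofPoly (C (qF ^ (-(m : ℤ) * (∑ i, v i) - (m : ℤ) ^ 2 * n)) *
      dilate (qF ^ m) (polyG (shiftComp m v))) /
    ∏ i, (ofPoly (X i) ^ m *
      qPoch (ofPoly (C qF)) (ofPoly (C (qF ^ (-(m : ℤ)) * tF ^ (1 - (n : ℤ)))) * (ofPoly (X i))⁻¹) m)

/-- `A_m(x; v) = ∏_i (q ^ (1 - m) a v̄_i⁻¹; q)_m / (q t ^ (n - 1) x_i; q)_m`. -/
def ratA {n : ℕ} (m : ℕ) (v : Fin n → ℤ) : RatFun n BaseK :=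
  ∏ i, (ofPoly (C (qPoch qK (qK ^ (1 - (m : ℤ)) * aK * (bar qK tK v i)⁻¹) m)) /
    qPoch (ofPoly (C qK)) (ofPoly (C (qK * tK ^ ((n : ℤ) - 1)) * X i)) m)

/-- The rational function `A_m(x; v) K_{v + (m ^ n)}(q ^ m x)`. -/
def shiftK {n : ℕ} (m : ℕ) (v : Fin n → ℤ) : RatFun n BaseK :=
  ratA m v * ofPoly (dilate (qK ^ m) (polyK (shiftComp m v)))

/-- The least `m ≥ 0` such that `v + (m ^ n)` is a composition. -/
def minShift {n : ℕ} (v : Fin n → ℤ) : ℕ :=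
  Finset.univ.sup fun i => (-v i).toNat

/-- `G_v ∈ 𝔽(x)` for an integral vector `v`. -/
def ratG {n : ℕ} (v : Fin n → ℤ) : RatFun n BaseF := shiftG (minShift v) v

/-- `K_v ∈ 𝕂(x)` for an integral vector `v`. -/
def ratK {n : ℕ} (v : Fin n → ℤ) : RatFun n BaseK := shiftK (minShift v) v

end InterpMac

end

/-! A polynomial of degree at most `d` which vanishes at the spectral vectors of all compositions of
size at most `d` is zero; this gives uniqueness. Existence is a determinant being nonzero, which
may be checked at `t = 1`, where products of factors `x_i - q ^ j` interpolate.

Hecke operators and the raising operator `Φ`, which sends `f(x)` to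
`(x_n - t ^ (1 - n)) f(x_n / q, x_1, …, x_{n - 1})`, permute the lines spanned by the `G_α`, and
`G_α` is an eigenvector of the inhomogeneous Cherednik operator `f ↦ x_1⁻¹ (f + H_1 ⋯ H_{n-1} Φ f)`;
evaluating the eigenvalue equation at `z τ` computes the scalar by which `Φ` acts on the `K_α`. The
values `K_v(a ũ)` then satisfy recurrences which are symmetric in `u` and `v`, and duality follows
by induction. Iterating `Φ` gives the passage from `v` to `v + (1 ^ n)`, which extends everything to
integral vectors. -/

noncomputable section

namespace InterpMac

open MvPolynomial

/-! ### Combinatorics of spectral vectors -/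

section Precedes

variable {n : ℕ}

/-- The strict total order on positions by decreasing entry of `v`, ties being broken from left to
right; `kIndex v i` is the rank of `i` in this order. -/
def Precedes (v : Fin n → ℤ) (k i : Fin n) : Prop :=
  v i < v k ∨ v i = v k ∧ k < i

instance (v : Fin n → ℤ) (k i : Fin n) : Decidable (Precedes v k i) :=
  inferInstanceAs (Decidable (_ ∨ _))

theorem not_precedes_self (v : Fin n → ℤ) (i : Fin n) : ¬ Precedes v i i := by
  simp [Precedes]

theorem kIndex_eq_card (v : Fin n → ℤ) (i : Fin n) :
    kIndex v i = (Finset.univ.filter fun k => Precedes v k i).card := by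
  rw [kIndex, ← Finset.card_union_of_disjoint]
  · congr 1
    ext k
    simp only [Precedes, Finset.mem_union, Finset.mem_filter, Finset.mem_univ, true_and]
    grind
  · exact Finset.disjoint_filter.mpr fun _ _ h h' => lt_asymm h.1 h'.1

theorem kIndex_eq_sum (v : Fin n → ℤ) (i : Fin n) :
    kIndex v i = ∑ k, if Precedes v k i then 1 else 0 := by
  rw [kIndex_eq_card, Finset.card_filter]

theorem precedes_comp_swap {i j : Fin n} (hij : (j : ℕ) = i + 1) {v : Fin n → ℤ}
    (hv : v i ≠ v j) (k l : Fin n) :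
    Precedes (v ∘ Equiv.swap i j) k l ↔
      Precedes v (Equiv.swap i j k) (Equiv.swap i j l) := by
  simp only [Precedes, Function.comp_apply, Equiv.swap_apply_def, Fin.lt_def]
  split_ifs <;> grind

theorem kIndex_comp_swap {i j : Fin n} (hij : (j : ℕ) = i + 1) {v : Fin n → ℤ}
    (hv : v i ≠ v j) (l : Fin n) :
    kIndex (v ∘ Equiv.swap i j) l = kIndex v (Equiv.swap i j l) := by
  simp only [kIndex_eq_sum, precedes_comp_swap hij hv]
  exact Equiv.sum_comp (Equiv.swap i j) fun k => if Precedes v k _ then 1 else 0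

theorem kIndex_of_eq {i j : Fin n} (hij : (j : ℕ) = i + 1) {v : Fin n → ℤ}
    (hv : v i = v j) : kIndex v j = kIndex v i + 1 := by
  rw [kIndex_eq_card, kIndex_eq_card, ← Finset.card_insert_of_notMem (a := i)]
  · congr 1
    ext k
    simp only [Finset.mem_filter, Finset.mem_insert, Finset.mem_univ, true_and, Precedes,
      Fin.lt_def, Fin.ext_iff]
    grind
  · simp [not_precedes_self]

theorem kIndex_add_intCast (v : Fin n → ℤ) (c : ℤ) (i : Fin n) :
    kIndex (v + (c : Fin n → ℤ)) i = kIndex v i := by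
  simp [kIndex]

theorem kIndex_zero (i : Fin n) : kIndex 0 i = i := by
  simp [kIndex, Finset.filter_gt_eq_Iio]

theorem precedes_neg_rev (v : Fin n → ℤ) (k i : Fin n) :
    Precedes (fun l => -v l.rev) k.rev i ↔ Precedes v i.rev k := by
  simp only [Precedes, Fin.rev_rev, neg_lt_neg_iff, neg_inj, Fin.rev_lt_iff, eq_comm]

theorem kIndex_neg_rev_add_kIndex (v : Fin n → ℤ) (i : Fin n) :
    kIndex (fun l => -v l.rev) i + kIndex v i.rev = n - 1 := by
  have exactly_one (k : Fin n) :
      ((if Precedes v i.rev k then 1 else 0) + if Precedes v k i.rev then 1 else 0) =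
        if k ≠ i.rev then 1 else 0 := by
    simp only [Precedes]
    grind
  rw [kIndex_eq_sum, kIndex_eq_sum, ← Equiv.sum_comp Fin.revPerm]
  simp only [Fin.revPerm_apply, precedes_neg_rev]
  rw [← Finset.sum_add_distrib, Finset.sum_congr rfl fun k _ => exactly_one k,
    ← Finset.card_filter, Finset.filter_ne', Finset.card_erase_of_mem (Finset.mem_univ _),
    Finset.card_univ, Fintype.card_fin]

theorem kIndex_castSucc_of_last_eq_zero {v : Fin (n + 1) → ℤ} (hv : 0 ≤ v)
    (h : v (Fin.last n) = 0) (i : Fin n) :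
    kIndex v i.castSucc = kIndex (v ∘ Fin.castSucc) i := by
  have not_precedes : ¬ Precedes v (Fin.last n) i.castSucc := by
    have := hv i.castSucc
    simp only [Precedes, h, Pi.zero_apply] at this ⊢
    grind [Fin.castSucc_lt_last]
  rw [kIndex_eq_sum, kIndex_eq_sum, Fin.sum_univ_castSucc, if_neg not_precedes, add_zero]
  refine Finset.sum_congr rfl fun k _ => if_congr ?_ rfl rfl
  simp only [Precedes, Fin.castSucc_lt_castSucc_iff, Function.comp_apply]

end Precedes

section Rotation

variable {n : ℕ}

/-- The cyclic raising map `(v_1, …, v_n) ↦ (v_2, …, v_n, v_1 + 1)`. -/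
def rot (v : Fin (n + 1) → ℤ) : Fin (n + 1) → ℤ :=
  Fin.snoc (α := fun _ => ℤ) (fun i : Fin n => v i.succ) (v 0 + 1)

@[simp] theorem rot_castSucc (v : Fin (n + 1) → ℤ) (i : Fin n) :
    rot v i.castSucc = v i.succ := by
  simp [rot]

@[simp] theorem rot_last (v : Fin (n + 1) → ℤ) : rot v (Fin.last n) = v 0 + 1 := by
  simp [rot]

theorem rot_add_one (v : Fin (n + 1) → ℤ) : rot (v + 1) = rot v + 1 := by
  funext i
  refine Fin.lastCases ?_ (fun i => ?_) i <;> simp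

theorem rot_nonneg {v : Fin (n + 1) → ℤ} (hv : 0 ≤ v) : 0 ≤ rot v := by
  intro i
  refine Fin.lastCases ?_ (fun i => ?_) i
  · simpa using (hv 0).trans (lt_add_one _).le
  · simpa using hv i.succ

theorem sum_rot (v : Fin (n + 1) → ℤ) : ∑ i, rot v i = ∑ i, v i + 1 := by
  rw [Fin.sum_univ_castSucc, Fin.sum_univ_succ]
  simp only [rot_castSucc, rot_last]
  ring

theorem kIndex_rot_castSucc (v : Fin (n + 1) → ℤ) (i : Fin n) :
    kIndex (rot v) i.castSucc = kIndex v i.succ := by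
  rw [kIndex_eq_sum, kIndex_eq_sum, Fin.sum_univ_castSucc, Fin.sum_univ_succ, add_comm]
  simp only [Precedes, rot_castSucc, rot_last, Fin.succ_lt_succ_iff, Fin.castSucc_lt_castSucc_iff,
    Fin.succ_pos, (Fin.castSucc_lt_last i).not_gt, and_true, and_false, or_false,
    Int.lt_add_one_iff, le_iff_lt_or_eq]

theorem kIndex_rot_last (v : Fin (n + 1) → ℤ) :
    kIndex (rot v) (Fin.last n) = kIndex v 0 := by
  rw [kIndex_eq_sum, kIndex_eq_sum, Fin.sum_univ_castSucc, Fin.sum_univ_succ, add_comm]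
  simp only [Precedes, rot_castSucc, rot_last, Fin.castSucc_lt_last, Fin.not_lt_zero, lt_irrefl,
    and_true, and_false, or_false, ← le_iff_lt_or_eq, Int.add_one_le_iff]

theorem rot_neg_rev_rot (v : Fin (n + 1) → ℤ) :
    rot (fun i => -rot v i.rev) = fun i => -v i.rev := by
  funext i
  refine Fin.lastCases ?_ (fun i => ?_) i
  · simp
  · rw [rot_castSucc, Fin.rev_succ, rot_castSucc, Fin.rev_castSucc]

theorem exists_rot_eq (w : Fin (n + 1) → ℤ) :
    ∃ v, rot v = w ∧ (0 ≤ w → w (Fin.last n) ≠ 0 → 0 ≤ v) := by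
  refine ⟨Fin.cons (α := fun _ => ℤ) (w (Fin.last n) - 1) fun i : Fin n => w i.castSucc,
    funext fun i => ?_, fun hw hlast i => ?_⟩
  · refine Fin.lastCases ?_ (fun i => ?_) i <;> simp
  · refine Fin.cases ?_ (fun i => ?_) i
    · have := hw (Fin.last n)
      simp only [Pi.zero_apply, Fin.cons_zero] at this ⊢
      omega
    · simpa using hw i.castSucc

theorem rot_surjective : Function.Surjective (rot (n := n)) := fun w =>
  (exists_rot_eq w).imp fun _ h => h.1

section Iterate

variable {ι β : Type*} {r : ι → ι} {F : ι → Fin (n + 1) → β}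

theorem iterate_apply_of_castSucc (hr : ∀ x i, F (r x) (Fin.castSucc i) = F x (Fin.succ i)) (x : ι)
    (m l : ℕ) (h : l + m < n + 1) : F (r^[m] x) ⟨l, by omega⟩ = F x ⟨l + m, h⟩ := by
  induction m generalizing l with
  | zero => rfl
  | succ m ih =>
    rw [Function.iterate_succ_apply', ← Fin.castSucc_mk (n := n) l (by omega), hr, Fin.succ_mk,
      ih _ (by omega)]
    simp only [add_assoc, add_comm 1 m]

theorem iterate_apply_zero_of_castSucc (hr : ∀ x i, F (r x) (Fin.castSucc i) = F x (Fin.succ i))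
    (x : ι) (i : Fin (n + 1)) : F (r^[i] x) 0 = F x i := by
  simpa using iterate_apply_of_castSucc hr x i 0 (by omega)

theorem iterate_eq_comp_of_castSucc_of_last
    (hr : ∀ x i, F (r x) (Fin.castSucc i) = F x (Fin.succ i)) {g : β → β}
    (hlast : ∀ x, F (r x) (Fin.last n) = g (F x 0)) (x : ι) : F (r^[n + 1] x) = g ∘ F x := by
  funext i
  have hsplit : n + 1 = (n - i) + (i + 1) := by omega
  have h := iterate_apply_of_castSucc hr (r^[i + 1] x) (n - i) i (by omega)
  rw [← Function.iterate_add_apply, ← hsplit] at h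
  rw [Fin.eta] at h
  rw [h, Function.comp_apply, ← iterate_apply_zero_of_castSucc hr x i, ← hlast,
    Function.iterate_succ_apply']
  exact congrArg _ (Fin.ext (by simp; omega))

end Iterate

theorem rot_iterate (v : Fin (n + 1) → ℤ) : rot^[n + 1] v = v + 1 :=
  iterate_eq_comp_of_castSucc_of_last (F := fun v => v) (g := (· + 1)) rot_castSucc rot_last v

end Rotation

section Induction

variable {n : ℕ}

theorem sum_comp_swap (v : Fin n → ℤ) (i j : Fin n) : ∑ l, (v ∘ Equiv.swap i j) l = ∑ l, v l :=
  Equiv.sum_comp (Equiv.swap i j) v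

theorem comp_swap_swap {α : Type*} (v : Fin n → α) (i j : Fin n) :
    (v ∘ Equiv.swap i j) ∘ Equiv.swap i j = v := by
  funext l
  simp

theorem comp_swap_of_eq {α : Type*} {v : Fin n → α} {i j : Fin n} (h : v i = v j) :
    v ∘ Equiv.swap i j = v := by
  rw [Equiv.comp_swap_eq_update, h, Function.update_eq_self, ← h, Function.update_eq_self]

theorem comp_perm_induction {α : Type*} {P : (Fin (n + 1) → α) → Prop}
    (swap : ∀ v (i j : Fin (n + 1)), (j : ℕ) = i + 1 → v i ≠ v j → P v → P (v ∘ Equiv.swap i j))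
    (σ : Equiv.Perm (Fin (n + 1))) {v : Fin (n + 1) → α} (hv : P v) : P (v ∘ σ) := by
  have hσ : σ ∈ Submonoid.closure (Set.range fun i : Fin n => Equiv.swap i.castSucc i.succ) := by
    rw [Equiv.Perm.mclosure_swap_castSucc_succ]
    trivial
  induction hσ using Submonoid.closure_induction generalizing v with
  | mem σ hσ =>
    obtain ⟨i, rfl⟩ := hσ
    by_cases h : v i.castSucc = v i.succ
    · rwa [comp_swap_of_eq h]
    · exact swap v _ _ (by simp) h hv
  | one => exact hv
  | mul _ _ _ _ hσ hρ => exact hρ (hσ hv)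

theorem nonneg_induction {P : (Fin (n + 1) → ℤ) → Prop} (zero : P 0)
    (swap : ∀ v, 0 ≤ v → ∀ i j : Fin (n + 1), (j : ℕ) = i + 1 → v i ≠ v j → P v →
      P (v ∘ Equiv.swap i j))
    (rotate : ∀ v, 0 ≤ v → P v → P (rot v)) {v : Fin (n + 1) → ℤ} (hv : 0 ≤ v) : P v := by
  obtain ⟨d, hd⟩ := Int.eq_ofNat_of_zero_le (Finset.sum_nonneg fun i (_ : i ∈ Finset.univ) => hv i)
  induction d generalizing v with
  | zero =>
    have := (Fintype.sum_eq_zero_iff_of_nonneg hv).mp hd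
    rwa [this]
  | succ d ih =>
    obtain ⟨i, hi⟩ : ∃ i, v i ≠ 0 := by
      by_contra! h
      simp only [h, Finset.sum_const_zero] at hd
      omega
    obtain ⟨u, hrot, hu⟩ := exists_rot_eq (v ∘ Equiv.swap i (Fin.last n))
    replace hu : 0 ≤ u := hu (fun _ => hv _) (by simpa using hi)
    have hP : P (v ∘ Equiv.swap i (Fin.last n)) := by
      refine hrot ▸ rotate u hu (ih hu ?_)
      have := sum_rot u
      rw [hrot, sum_comp_swap, hd] at this
      push_cast at this
      linarith
    rw [← comp_swap_swap v i (Fin.last n)]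
    have h0 : 0 ≤ v ∘ Equiv.swap i (Fin.last n) := fun _ => hv _
    refine (comp_perm_induction (P := fun w => 0 ≤ w ∧ P w) (fun w i j hij hw h => ?_) _
      ⟨h0, hP⟩).2
    exact ⟨fun _ => h.1 _, swap w h.1 i j hij hw h.2⟩

theorem add_natCast_nonneg_iff {v : Fin n → ℤ} {m : ℕ} :
    0 ≤ v + (m : Fin n → ℤ) ↔ minShift v ≤ m := by
  simp only [minShift, Finset.sup_le_iff, Finset.mem_univ, true_imp_iff, Pi.le_def, Pi.zero_apply,
    Pi.add_apply, Pi.natCast_apply]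
  exact forall_congr' fun i => by omega

theorem shift_induction {P : (Fin n → ℤ) → Prop} (nonneg : ∀ v, 0 ≤ v → P v)
    (shift : ∀ v, P (v + 1) → P v) (v : Fin n → ℤ) : P v := by
  suffices ∀ (m : ℕ) (v : Fin n → ℤ), 0 ≤ v + (m : Fin n → ℤ) → P v by
    exact this (minShift v) v (add_natCast_nonneg_iff.mpr le_rfl)
  intro m
  induction m with
  | zero => exact fun v hv => nonneg v (by simpa using hv)
  | succ m ih => exact fun v hv => shift v (ih _ (by rwa [add_assoc, add_comm 1, ← Nat.cast_succ]))

theorem int_induction {P : (Fin (n + 1) → ℤ) → Prop} (zero : P 0)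
    (swap : ∀ v (i j : Fin (n + 1)), (j : ℕ) = i + 1 → v i ≠ v j → P v → P (v ∘ Equiv.swap i j))
    (rotate : ∀ v, P (rot v) ↔ P v) (v : Fin (n + 1) → ℤ) : P v := by
  have iterate (m : ℕ) (v : Fin (n + 1) → ℤ) : P (rot^[m] v) ↔ P v := by
    induction m with
    | zero => rfl
    | succ m ih => rw [Function.iterate_succ_apply', rotate, ih]
  refine shift_induction (fun v hv => ?_) (fun v hv => ?_) v
  · exact nonneg_induction zero (fun v _ => swap v) (fun v _ => (rotate v).mpr) hv
  · rwa [← iterate (n + 1), rot_iterate]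

end Induction

section Bar

variable {k : Type*} [Field k] {q t : k} {n : ℕ}

theorem bar_comp_swap {i j : Fin n} (hij : (j : ℕ) = i + 1) {v : Fin n → ℤ}
    (hv : v i ≠ v j) : bar q t (v ∘ Equiv.swap i j) = bar q t v ∘ Equiv.swap i j := by
  funext l
  simp [bar, kIndex_comp_swap hij hv]

theorem bar_of_eq (ht : t ≠ 0) {i j : Fin n} (hij : (j : ℕ) = i + 1) {v : Fin n → ℤ}
    (hv : v i = v j) : bar q t v i = t * bar q t v j := by
  simp only [bar, kIndex_of_eq hij hv, hv, mul_left_comm t, ← zpow_one_add₀ ht]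
  congr 2
  omega

theorem bar_add_intCast (hq : q ≠ 0) (v : Fin n → ℤ) (c : ℤ) :
    bar q t (v + (c : Fin n → ℤ)) = q ^ c • bar q t v := by
  funext i
  simp only [bar, kIndex_add_intCast, Pi.add_apply, Pi.intCast_apply, Int.cast_id, zpow_add₀ hq,
    Pi.smul_apply, smul_eq_mul]
  ring

theorem bar_zero : bar q t (0 : Fin n → ℤ) = tau t n := by
  funext i
  simp [bar, tau, kIndex_zero]

theorem bar_ne_zero (hq : q ≠ 0) (ht : t ≠ 0) (v : Fin n → ℤ) (i : Fin n) :
    bar q t v i ≠ 0 :=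
  mul_ne_zero (zpow_ne_zero _ hq) (zpow_ne_zero _ ht)

theorem tau_ne_zero (ht : t ≠ 0) (i : Fin n) : tau t n i ≠ 0 := zpow_ne_zero _ ht

theorem tau_of_adj (ht : t ≠ 0) {i j : Fin n} (hij : (j : ℕ) = i + 1) :
    tau t n i = t * tau t n j := by
  simpa only [bar_zero] using bar_of_eq (q := t) ht hij (v := 0) rfl

theorem bar_castSucc_of_last_eq_zero {v : Fin (n + 1) → ℤ} (hv : 0 ≤ v)
    (h : v (Fin.last n) = 0) (i : Fin n) :
    bar q t v i.castSucc = bar q t (v ∘ Fin.castSucc) i := by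
  simp only [bar, kIndex_castSucc_of_last_eq_zero hv h, Function.comp_apply]

theorem bar_rot_castSucc (v : Fin (n + 1) → ℤ) (i : Fin n) :
    bar q t (rot v) i.castSucc = bar q t v i.succ := by
  simp [bar, kIndex_rot_castSucc]

theorem bar_rot_last (hq : q ≠ 0) (v : Fin (n + 1) → ℤ) :
    bar q t (rot v) (Fin.last n) = q * bar q t v 0 := by
  simp only [bar, rot_last, kIndex_rot_last, zpow_add_one₀ hq]
  ring

theorem bar_rot_iterate_zero (v : Fin (n + 1) → ℤ) (i : Fin (n + 1)) :
    bar q t (rot^[i] v) 0 = bar q t v i :=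
  iterate_apply_zero_of_castSucc (F := bar q t) bar_rot_castSucc v i

theorem tilde_eq (ht : t ≠ 0) (v : Fin n → ℤ) (i : Fin n) :
    tilde q t v i = t ^ (1 - (n : ℤ)) * (bar q t v i.rev)⁻¹ := by
  have h := kIndex_neg_rev_add_kIndex v i
  have hn := i.pos
  simp only [tilde, bar, mul_inv, ← zpow_neg, neg_neg]
  rw [mul_left_comm, ← zpow_add₀ ht]
  congr 2
  omega

theorem tilde_zero : tilde q t (0 : Fin n → ℤ) = tau t n := by
  rw [← bar_zero (q := q), tilde]
  congr 1

theorem tilde_comp_swap {i j : Fin n} (hij : (j : ℕ) = i + 1) {v : Fin n → ℤ} (hv : v i ≠ v j) :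
    tilde q t (v ∘ Equiv.swap i j) = tilde q t v ∘ Equiv.swap j.rev i.rev := by
  have hij' : ((i.rev : Fin n) : ℕ) = j.rev + 1 := by
    simp only [Fin.val_rev]
    omega
  rw [tilde, tilde, ← bar_comp_swap hij' (by simpa using hv.symm)]
  congr 1
  funext l
  simp only [Function.comp_apply, Equiv.swap_comm j.rev, neg_inj, Equiv.swap_apply_def,
    ← Fin.rev_eq_iff]
  split_ifs <;> simp

theorem tilde_add_intCast (hq : q ≠ 0) (v : Fin n → ℤ) (c : ℤ) :
    tilde q t (v + (c : Fin n → ℤ)) = q ^ (-c) • tilde q t v := by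
  rw [tilde, tilde, ← bar_add_intCast hq]
  congr 1
  funext i
  simp [add_comm]

end Bar

section Unrot

variable {k : Type*} [Field k] {q t : k} {n : ℕ}

/-- The map `x ↦ (x_n / q, x_1, …, x_{n-1})` on points, which undoes `rot` on spectral vectors. -/
def unrot (q : k) (x : Fin (n + 1) → k) : Fin (n + 1) → k :=
  Fin.cons (α := fun _ => k) (q⁻¹ * x (Fin.last n)) fun i : Fin n => x i.castSucc

@[simp] theorem unrot_zero (x : Fin (n + 1) → k) : unrot q x 0 = q⁻¹ * x (Fin.last n) := by
  simp [unrot]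

@[simp] theorem unrot_succ (x : Fin (n + 1) → k) (i : Fin n) :
    unrot q x i.succ = x i.castSucc := by
  simp [unrot]

theorem unrot_bar_rot (hq : q ≠ 0) (v : Fin (n + 1) → ℤ) :
    unrot q (bar q t (rot v)) = bar q t v := by
  funext i
  refine Fin.cases ?_ (fun i => ?_) i
  · simp [bar_rot_last hq, hq]
  · simp [bar_rot_castSucc]

theorem unrot_smul (c : k) (x : Fin (n + 1) → k) : unrot q (c • x) = c • unrot q x := by
  funext i
  refine Fin.cases ?_ (fun i => ?_) i
  · simp [mul_left_comm]
  · simp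

theorem unrot_tilde (hq : q ≠ 0) (v : Fin (n + 1) → ℤ) :
    unrot q (tilde q t v) = tilde q t (rot v) := by
  rw [tilde, ← rot_neg_rev_rot, unrot_bar_rot hq, tilde]

theorem unrot_rev_castSucc (x : Fin (n + 1) → k) (i : Fin n) :
    unrot q x i.castSucc.rev = x i.succ.rev := by
  rw [Fin.rev_castSucc, unrot_succ, Fin.rev_succ]

theorem unrot_iterate_last (x : Fin (n + 1) → k) (i : Fin (n + 1)) :
    (unrot q)^[i] x (Fin.last n) = x i.rev := by
  simpa using iterate_apply_zero_of_castSucc (F := fun x i => x i.rev) unrot_rev_castSucc x i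

theorem unrot_iterate (x : Fin (n + 1) → k) : (unrot q)^[n + 1] x = q⁻¹ • x := by
  have := iterate_eq_comp_of_castSucc_of_last (F := fun x (i : Fin (n + 1)) => x i.rev)
    (g := (q⁻¹ * ·)) (unrot_rev_castSucc (q := q)) (fun x => by simp) x
  funext i
  simpa using congrFun this i.rev

end Unrot

/-! ### Substitutions in polynomials -/

section Substitution

variable {R σ τ : Type*} [CommRing R]

theorem totalDegree_bind₁_le {g : σ → MvPolynomial τ R} (hg : ∀ i, (g i).totalDegree ≤ 1)
    (f : MvPolynomial σ R) : (bind₁ g f).totalDegree ≤ f.totalDegree := by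
  rw [bind₁, aeval_def, eval₂_eq]
  refine totalDegree_finsetSum_le fun d hd => (totalDegree_mul _ _).trans ?_
  rw [algebraMap_eq, totalDegree_C, zero_add]
  refine (totalDegree_finsetProd _ _).trans
    (le_trans (Finset.sum_le_sum fun i _ => ?_) (le_totalDegree hd))
  exact (totalDegree_pow _ _).trans (by simpa using Nat.mul_le_mul_left (d i) (hg i))

theorem eval_bind₁ (g : σ → MvPolynomial τ R) (f : MvPolynomial σ R) (x : τ → R) :
    eval x (bind₁ g f) = eval (fun i => eval x (g i)) f :=
  eval₂Hom_bind₁ (RingHom.id R) x g f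

theorem dvd_sub_bind₁ {p : MvPolynomial σ R} {g : σ → MvPolynomial σ R}
    (hg : ∀ i, p ∣ X i - g i) (f : MvPolynomial σ R) : p ∣ f - bind₁ g f := by
  have h : (Ideal.Quotient.mkₐ R (Ideal.span {p})).comp (bind₁ g) =
      Ideal.Quotient.mkₐ R (Ideal.span {p}) := by
    ext i
    simpa [eq_comm (a := Ideal.Quotient.mk _ (g i)), Ideal.Quotient.mk_eq_mk_iff_sub_mem,
      Ideal.mem_span_singleton] using hg i
  rw [← Ideal.mem_span_singleton, ← Ideal.Quotient.mk_eq_mk_iff_sub_mem]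
  exact (DFunLike.congr_fun h f).symm

/-- The polynomial obtained from `f` by substituting `c i * X i` for each variable `X i`. -/
def scaleVars (c : σ → R) (f : MvPolynomial σ R) : MvPolynomial σ R :=
  bind₁ (fun i => C (c i) * X i) f

theorem eval_scaleVars (c : σ → R) (f : MvPolynomial σ R) (x : σ → R) :
    eval x (scaleVars c f) = eval (c * x) f := by
  rw [scaleVars, eval_bind₁]
  congr 2
  funext i
  simp

theorem scaleVars_monomial (c : σ → R) (s : σ →₀ ℕ) (r : R) :
    scaleVars c (monomial s r) = monomial s ((s.prod fun i e => c i ^ e) * r) := by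
  rw [scaleVars, bind₁_monomial, monomial_eq]
  simp only [Finsupp.prod, mul_pow, Finset.prod_mul_distrib, map_mul, map_prod, map_pow]
  ring

theorem coeff_scaleVars (c : σ → R) (f : MvPolynomial σ R) (s : σ →₀ ℕ) :
    coeff s (scaleVars c f) = (s.prod fun i e => c i ^ e) * coeff s f := by
  classical
  induction f using MvPolynomial.induction_on' with
  | monomial u r =>
    rw [scaleVars_monomial, coeff_monomial, coeff_monomial, mul_ite, mul_zero]
    exact ite_congr rfl (fun h => by rw [h]) fun _ => rfl
  | add f g hf hg =>
    simp only [scaleVars, map_add, coeff_add, mul_add] at hf hg ⊢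
    rw [hf, hg]

theorem scaleVars_scaleVars (c d : σ → R) (f : MvPolynomial σ R) :
    scaleVars c (scaleVars d f) = scaleVars (c * d) f := by
  ext s
  simp only [coeff_scaleVars, Pi.mul_apply, mul_pow, Finsupp.prod_mul, mul_assoc]

theorem scaleVars_one (f : MvPolynomial σ R) : scaleVars 1 f = f := by
  ext s
  simp [coeff_scaleVars]

theorem totalDegree_scaleVars_le (c : σ → R) (f : MvPolynomial σ R) :
    (scaleVars c f).totalDegree ≤ f.totalDegree := by
  refine Finset.sup_mono fun s hs => ?_
  rw [mem_support_iff, coeff_scaleVars] at hs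
  exact mem_support_iff.mpr (right_ne_zero_of_mul hs)

variable [Nontrivial R]

theorem totalDegree_X_sub_C (i : σ) (c : R) : (X i - C c).totalDegree = 1 := by
  rw [sub_eq_add_neg, ← map_neg, totalDegree_add_eq_left_of_totalDegree_lt] <;> simp

theorem X_sub_C_ne_zero (i : σ) (c : R) : X i - C c ≠ 0 :=
  fun h => by simpa [h] using totalDegree_X_sub_C i c

theorem X_sub_X_ne_zero {i j : σ} (hij : i ≠ j) : (X i - X j : MvPolynomial σ R) ≠ 0 :=
  sub_ne_zero.mpr fun h => hij (X_injective h)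

end Substitution

section RestrictLast

variable {R : Type*} [CommRing R] {n : ℕ}

/-- The polynomial `f(x_1, …, x_n, c)`. -/
def restrictLast (c : R) (f : MvPolynomial (Fin (n + 1)) R) : MvPolynomial (Fin n) R :=
  bind₁ (Fin.snoc (α := fun _ => MvPolynomial (Fin n) R) X (C c)) f

theorem eval_restrictLast (c : R) (f : MvPolynomial (Fin (n + 1)) R) (x : Fin n → R) :
    eval x (restrictLast c f) = eval (Fin.snoc (α := fun _ => R) x c) f := by
  rw [restrictLast, eval_bind₁]
  congr 2
  funext i
  refine Fin.lastCases ?_ (fun i => ?_) i <;> simp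

theorem totalDegree_restrictLast_le (c : R) (f : MvPolynomial (Fin (n + 1)) R) :
    (restrictLast c f).totalDegree ≤ f.totalDegree := by
  refine totalDegree_bind₁_le (fun i => ?_) f
  refine Fin.lastCases ?_ (fun i => ?_) i
  · simp
  · rw [Fin.snoc_castSucc]
    exact (totalDegree_monomial_le _ _).trans (by simp)

theorem X_last_sub_C_dvd_of_restrictLast_eq_zero {c : R} {f : MvPolynomial (Fin (n + 1)) R}
    (h : restrictLast c f = 0) : X (Fin.last n) - C c ∣ f := by
  have hdvd := dvd_sub_bind₁ (p := X (Fin.last n) - C c)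
    (g := fun i => rename Fin.castSucc
      (Fin.snoc (α := fun _ => MvPolynomial (Fin n) R) X (C c) i)) (fun i => ?_) f
  · rwa [← rename_bind₁, ← restrictLast, h, map_zero, sub_zero] at hdvd
  · refine Fin.lastCases ?_ (fun i => ?_) i <;> simp

end RestrictLast

/-! ### Cyclic raising and the vanishing theorem -/

section Generic

variable {k : Type*} [Field k] {q t : k} {n : ℕ}

/-- The conditions on the parameters `q` and `t` under which interpolation works: `q` and `t` are
nonzero and the only power of `q` that is a power of `t` is `q ^ 0`. -/
structure Generic (q t : k) : Prop where
  q_ne : q ≠ 0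
  t_ne : t ≠ 0
  pow_ne : ∀ m b : ℤ, m ≠ 0 → q ^ m ≠ t ^ b

theorem Generic.eq_zero_of_bar_eq (h : Generic q t) {v : Fin n → ℤ} {i : Fin n} {b : ℤ}
    (hv : bar q t v i = t ^ b) : v i = 0 := by
  by_contra h0
  refine h.pow_ne (v i) (b + kIndex v i) h0 ?_
  rw [zpow_add₀ h.t_ne, ← hv, bar, mul_assoc, ← zpow_add₀ h.t_ne]
  simp

theorem Generic.bar_ne_of_ne (h : Generic q t) {v : Fin n → ℤ} {i j : Fin n} (hv : v i ≠ v j)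
    (b : ℤ) : bar q t v i ≠ t ^ b * bar q t v j := by
  intro heq
  refine h.pow_ne (v i - v j) (b - kIndex v j + kIndex v i) (sub_ne_zero.mpr hv) ?_
  have := h.t_ne
  rw [zpow_sub₀ h.q_ne, div_eq_iff (zpow_ne_zero _ h.q_ne), zpow_add₀ h.t_ne, zpow_sub₀ h.t_ne]
  simp only [bar, zpow_neg] at heq
  field_simp at heq ⊢
  linear_combination heq

theorem Generic.bar_sub_ne_zero (h : Generic q t) (ht : t ≠ 1) (v : Fin n → ℤ) {i j : Fin n}
    (hij : (j : ℕ) = i + 1) : bar q t v i - bar q t v j ≠ 0 := by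
  rw [sub_ne_zero]
  by_cases hv : v i = v j
  · rw [bar_of_eq h.t_ne hij hv]
    exact fun heq => ht (mul_eq_right₀ (bar_ne_zero h.q_ne h.t_ne v j) |>.mp heq)
  · simpa using h.bar_ne_of_ne hv 0

theorem bar_last_of_eq_zero {v : Fin (n + 1) → ℤ} (hv : 0 ≤ v) (h : v (Fin.last n) = 0) :
    bar q t v (Fin.last n) = t ^ (-(n : ℤ)) := by
  have hlast : kIndex v (Fin.last n) = n := by
    have precedes_last (i : Fin n) : Precedes v i.castSucc (Fin.last n) := by
      simpa only [Precedes, h, i.castSucc_lt_last, and_true] using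
        lt_or_eq_of_le (a := 0) (hv i.castSucc)
    rw [kIndex_eq_sum, Fin.sum_univ_castSucc]
    simp [precedes_last, not_precedes_self]
  simp [bar, h, hlast]

theorem bar_snoc_zero {v : Fin n → ℤ} (hv : 0 ≤ v) :
    bar q t (Fin.snoc (α := fun _ => ℤ) v 0) =
      Fin.snoc (α := fun _ => k) (bar q t v) (t ^ (-(n : ℤ))) := by
  have hv' : (0 : Fin (n + 1) → ℤ) ≤ Fin.snoc (α := fun _ => ℤ) v 0 := by
    refine fun i => Fin.lastCases ?_ (fun i => ?_) i
    · simp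
    · simpa using hv i
  funext i
  refine Fin.lastCases ?_ (fun i => ?_) i
  · rw [bar_last_of_eq_zero hv' (by simp), Fin.snoc_last]
  · rw [bar_castSucc_of_last_eq_zero hv' (by simp), Fin.snoc_castSucc]
    exact congrArg (fun w => bar q t w i) (funext fun j => by simp)

/-- The polynomial `f(x_n / q, x_1, …, x_{n-1})`. -/
def unrotPoly (q : k) (f : MvPolynomial (Fin (n + 1)) k) : MvPolynomial (Fin (n + 1)) k :=
  rename (finRotate (n + 1)).symm (scaleVars (Pi.mulSingle 0 q⁻¹) f)

theorem finRotate_symm_zero : (finRotate (n + 1)).symm 0 = Fin.last n := by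
  rw [Equiv.symm_apply_eq, finRotate_last]

theorem finRotate_symm_succ (i : Fin n) : (finRotate (n + 1)).symm i.succ = i.castSucc := by
  rw [Equiv.symm_apply_eq, finRotate_apply, Fin.coeSucc_eq_succ]

theorem eval_unrotPoly (f : MvPolynomial (Fin (n + 1)) k) (x : Fin (n + 1) → k) :
    eval x (unrotPoly q f) = eval (unrot q x) f := by
  rw [unrotPoly, eval_rename, eval_scaleVars]
  congr 2
  funext i
  refine Fin.cases ?_ (fun i => ?_) i
  · rw [Pi.mul_apply, Function.comp_apply, finRotate_symm_zero, Pi.mulSingle_eq_same, unrot_zero]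
  · rw [Pi.mul_apply, Function.comp_apply, finRotate_symm_succ,
      Pi.mulSingle_eq_of_ne (Fin.succ_ne_zero i), unrot_succ, one_mul]

theorem totalDegree_unrotPoly_le (f : MvPolynomial (Fin (n + 1)) k) :
    (unrotPoly q f).totalDegree ≤ f.totalDegree :=
  (totalDegree_rename_le _ _).trans (totalDegree_scaleVars_le _ _)

theorem exists_unrotPoly_eq (hq : q ≠ 0) (g : MvPolynomial (Fin (n + 1)) k) :
    ∃ h, unrotPoly q h = g ∧ h.totalDegree ≤ g.totalDegree := by
  refine ⟨scaleVars (Pi.mulSingle 0 q) (rename (finRotate (n + 1)) g), ?_,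
    (totalDegree_scaleVars_le _ _).trans (totalDegree_rename_le _ _)⟩
  rw [unrotPoly, scaleVars_scaleVars, ← Pi.mulSingle_mul, inv_mul_cancel₀ hq,
    Pi.mulSingle_one, scaleVars_one, rename_rename]
  simp

/-- The raising operator `f ↦ (x_n - t ^ (1 - n)) f(x_n / q, x_1, …, x_{n-1})`. -/
def raise (q t : k) (f : MvPolynomial (Fin (n + 1)) k) : MvPolynomial (Fin (n + 1)) k :=
  (X (Fin.last n) - C (t ^ (-(n : ℤ)))) * unrotPoly q f

theorem eval_raise (f : MvPolynomial (Fin (n + 1)) k) (x : Fin (n + 1) → k) :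
    eval x (raise q t f) = (x (Fin.last n) - t ^ (-(n : ℤ))) * eval (unrot q x) f := by
  simp [raise, eval_unrotPoly]

theorem totalDegree_raise_le (f : MvPolynomial (Fin (n + 1)) k) :
    (raise q t f).totalDegree ≤ f.totalDegree + 1 := by
  refine (totalDegree_mul _ _).trans ?_
  rw [totalDegree_X_sub_C, add_comm]
  exact Nat.add_le_add_right (totalDegree_unrotPoly_le f) 1

theorem eval_bar_rot_raise (hq : q ≠ 0) (v : Fin (n + 1) → ℤ)
    (f : MvPolynomial (Fin (n + 1)) k) : eval (bar q t (rot v)) (raise q t f) =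
      (q * bar q t v 0 - t ^ (-(n : ℤ))) * eval (bar q t v) f := by
  rw [eval_raise, unrot_bar_rot hq, bar_rot_last hq]

theorem Generic.bar_rot_last_ne (h : Generic q t) {v : Fin (n + 1) → ℤ} (hv : 0 ≤ v) :
    q * bar q t v 0 - t ^ (-(n : ℤ)) ≠ 0 := by
  rw [← bar_rot_last h.q_ne, sub_ne_zero]
  intro heq
  have := h.eq_zero_of_bar_eq heq
  have := hv 0
  simp only [Pi.zero_apply, rot_last] at *
  omega

theorem eval_bar_raise_eq_zero (hq : q ≠ 0) {w : Fin (n + 1) → ℤ} (hw : 0 ≤ w)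
    {f : MvPolynomial (Fin (n + 1)) k}
    (h : ∀ u, 0 ≤ u → rot u = w → eval (bar q t u) f = 0) :
    eval (bar q t w) (raise q t f) = 0 := by
  obtain ⟨u, rfl, hu⟩ := exists_rot_eq w
  by_cases hlast : rot u (Fin.last n) = 0
  · rw [eval_raise, bar_last_of_eq_zero hw hlast, sub_self, zero_mul]
  · rw [eval_bar_rot_raise hq, h u (hu hw hlast) rfl, mul_zero]

theorem exists_raise_eq (hq : q ≠ 0) {f : MvPolynomial (Fin (n + 1)) k} (hf : f ≠ 0)
    (h : restrictLast (t ^ (-(n : ℤ))) f = 0) :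
    ∃ g, raise q t g = f ∧ g.totalDegree + 1 ≤ f.totalDegree := by
  obtain ⟨g, rfl⟩ := X_last_sub_C_dvd_of_restrictLast_eq_zero h
  obtain ⟨g, rfl, hdeg⟩ := exists_unrotPoly_eq hq g
  refine ⟨g, rfl, ?_⟩
  rw [totalDegree_mul_of_isDomain (X_sub_C_ne_zero _ _) (right_ne_zero_of_mul hf),
    totalDegree_X_sub_C, add_comm]
  omega

/-- The polynomial `f` vanishes at the spectral vectors of all compositions of size at most `d`. -/
def VanishesUpTo (q t : k) (d : ℕ) (f : MvPolynomial (Fin n) k) : Prop :=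
  ∀ v : Fin n → ℤ, 0 ≤ v → ∑ i, v i ≤ d → eval (bar q t v) f = 0

theorem VanishesUpTo.restrictLast {d : ℕ} {f : MvPolynomial (Fin (n + 1)) k}
    (hf : VanishesUpTo q t d f) : VanishesUpTo q t d (restrictLast (t ^ (-(n : ℤ))) f) := by
  intro v hv hd
  rw [eval_restrictLast, ← bar_snoc_zero hv]
  refine hf _ (fun i => Fin.lastCases ?_ (fun i => ?_) i) (by simpa [Fin.sum_univ_castSucc])
  · simp
  · simpa using hv i

theorem VanishesUpTo.of_raise (hqt : Generic q t) {d : ℕ} {f : MvPolynomial (Fin (n + 1)) k}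
    (hf : VanishesUpTo q t (d + 1) (raise q t f)) : VanishesUpTo q t d f := by
  intro v hv hd
  have h := hf (rot v) (rot_nonneg hv) (by rw [sum_rot]; push_cast; linarith)
  rw [eval_bar_rot_raise hqt.q_ne, mul_eq_zero] at h
  exact h.resolve_left (hqt.bar_rot_last_ne hv)

theorem VanishesUpTo.eq_zero (hqt : Generic q t) {d : ℕ} {f : MvPolynomial (Fin n) k}
    (hf : VanishesUpTo q t d f) (hd : f.totalDegree ≤ d) : f = 0 := by
  induction n generalizing d with
  | zero =>
    have h := hf 0 le_rfl (by simp)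
    rw [eq_C_of_isEmpty f, eval_C] at h
    rw [eq_C_of_isEmpty f, h, map_zero]
  | succ n ihn =>
    by_contra hne
    obtain ⟨g, rfl, hg⟩ := exists_raise_eq hqt.q_ne hne
      (ihn hf.restrictLast ((totalDegree_restrictLast_le _ f).trans hd))
    induction d generalizing g with
    | zero => omega
    | succ d ihd =>
      have hg0 : g ≠ 0 := by
        rintro rfl
        simp [raise, unrotPoly, scaleVars] at hne
      have hgv := hf.of_raise hqt
      obtain ⟨g', rfl, hg'⟩ := exists_raise_eq hqt.q_ne hg0
        (ihn hgv.restrictLast ((totalDegree_restrictLast_le _ g).trans (by omega)))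
      exact ihd g' hgv (by omega) hg0 (by omega)

end Generic

/-! ### Demazure–Lusztig operators -/

section Hecke

variable {k σ : Type*} [Field k] [DecidableEq σ] {t : k} {i j : σ}

theorem X_sub_X_dvd_sub_rename (i j : σ) (f : MvPolynomial σ k) :
    X i - X j ∣ f - rename (Equiv.swap i j) f := by
  rw [← aeval_X_left_apply (rename (Equiv.swap i j) f), aeval_rename]
  refine dvd_sub_bind₁ (fun l => ?_) f
  rw [Function.comp_apply, Equiv.swap_apply_def]
  split_ifs with hi hj
  · rw [hi]
  · rw [hj, dvd_sub_comm]
  · rw [sub_self]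
    exact dvd_zero _

/-- The divided difference `(f - s f) / (x_i - x_j)`, where `s` interchanges `x_i` and `x_j`. -/
def dividedDiff (i j : σ) (f : MvPolynomial σ k) : MvPolynomial σ k :=
  (X_sub_X_dvd_sub_rename i j f).choose

theorem X_sub_X_mul_dividedDiff (i j : σ) (f : MvPolynomial σ k) :
    (X i - X j) * dividedDiff i j f = f - rename (Equiv.swap i j) f :=
  (X_sub_X_dvd_sub_rename i j f).choose_spec.symm

theorem totalDegree_X_mul_dividedDiff_le (hij : i ≠ j) (f : MvPolynomial σ k) :
    (X i * dividedDiff i j f).totalDegree ≤ f.totalDegree := by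
  by_cases h0 : dividedDiff i j f = 0
  · simp [h0]
  have hdeg : (X i - X j : MvPolynomial σ k).totalDegree = 1 :=
    ((isHomogeneous_X k i).sub (isHomogeneous_X k j)).totalDegree (X_sub_X_ne_zero hij)
  rw [totalDegree_mul_of_isDomain (X_ne_zero i) h0, totalDegree_X, ← hdeg,
    ← totalDegree_mul_of_isDomain (X_sub_X_ne_zero hij) h0, X_sub_X_mul_dividedDiff]
  exact (totalDegree_sub _ _).trans (max_le le_rfl (totalDegree_rename_le _ _))

/-- The Demazure–Lusztig operator `f ↦ t (s f) + (t - 1) x_i (f - s f) / (x_i - x_j)`. -/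
def hecke (t : k) (i j : σ) (f : MvPolynomial σ k) : MvPolynomial σ k :=
  C t * rename (Equiv.swap i j) f + C (t - 1) * (X i * dividedDiff i j f)

theorem eval_hecke (f : MvPolynomial σ k) (x : σ → k) :
    (x i - x j) * eval x (hecke t i j f) =
      (t - 1) * x i * eval x f + (x i - t * x j) * eval (x ∘ Equiv.swap i j) f := by
  have h := congrArg (eval x) (X_sub_X_mul_dividedDiff i j f)
  simp only [map_mul, map_sub, eval_X, eval_rename] at h
  simp only [hecke, map_mul, map_add, eval_X, eval_rename, eval_C]
  linear_combination (t - 1) * x i * h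

theorem eval_hecke_of_eq_zero (f : MvPolynomial σ k) {x : σ → k} (hx : x i = 0) :
    eval x (hecke t i j f) = t * eval (x ∘ Equiv.swap i j) f := by
  simp [hecke, hx, eval_rename]

theorem eval_hecke_of_eq_mul (ht : t ≠ 1) (f : MvPolynomial σ k) {x : σ → k}
    (hx : x i = t * x j) (hj : x j ≠ 0) : eval x (hecke t i j f) = t * eval x f := by
  have h := eval_hecke (t := t) (i := i) (j := j) f x
  rw [hx, sub_self, zero_mul, add_zero] at h
  apply mul_left_cancel₀ (mul_ne_zero (sub_ne_zero.mpr ht) hj)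
  linear_combination h

theorem totalDegree_hecke_le (hij : i ≠ j) (f : MvPolynomial σ k) :
    (hecke t i j f).totalDegree ≤ f.totalDegree := by
  refine (totalDegree_add _ _).trans (max_le ?_ ?_) <;>
    refine (totalDegree_mul _ _).trans ?_ <;> rw [totalDegree_C, zero_add]
  · exact totalDegree_rename_le _ _
  · exact totalDegree_X_mul_dividedDiff_le hij f

end Hecke

/-! ### Interpolation lines -/

section InterpLine

variable {k : Type*} [Field k] {q t : k} {n : ℕ} {v : Fin n → ℤ} {f g : MvPolynomial (Fin n) k}

/-- The polynomials of degree at most `|v|` which vanish at the spectral vectors of all compositions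
`w ≠ v` with `|w| ≤ |v|`. For generic parameters and `v ≥ 0` this space has dimension one. -/
def interpLine (q t : k) (v : Fin n → ℤ) : Submodule k (MvPolynomial (Fin n) k) where
  carrier := {f | f.totalDegree ≤ (∑ i, v i).toNat ∧
    ∀ w, 0 ≤ w → ∑ i, w i ≤ ∑ i, v i → w ≠ v → eval (bar q t w) f = 0}
  zero_mem' := by simp
  add_mem' hf hg := by
    refine ⟨(totalDegree_add _ _).trans (max_le hf.1 hg.1), fun w h0 hw hne => ?_⟩
    rw [map_add, hf.2 w h0 hw hne, hg.2 w h0 hw hne, add_zero]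
  smul_mem' c f hf := by
    refine ⟨(totalDegree_smul_le c f).trans hf.1, fun w h0 hw hne => ?_⟩
    rw [smul_eval, hf.2 w h0 hw hne, mul_zero]

theorem eq_zero_of_eval_bar_eq_zero (hqt : Generic q t) (hv : 0 ≤ v) (hf : f ∈ interpLine q t v)
    (h : eval (bar q t v) f = 0) : f = 0 := by
  have hsum : (((∑ i, v i).toNat : ℕ) : ℤ) = ∑ i, v i :=
    Int.toNat_of_nonneg (Finset.sum_nonneg fun i _ => hv i)
  refine VanishesUpTo.eq_zero hqt (fun w hw hd => ?_) hf.1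
  by_cases hwv : w = v
  · rw [hwv, h]
  · exact hf.2 w hw (hsum ▸ hd) hwv

theorem exists_eq_smul (hqt : Generic q t) (hv : 0 ≤ v) (hf : f ∈ interpLine q t v)
    (hg : g ∈ interpLine q t v) (hg0 : g ≠ 0) : ∃ c : k, f = c • g := by
  have hgv : eval (bar q t v) g ≠ 0 := fun h => hg0 (eq_zero_of_eval_bar_eq_zero hqt hv hg h)
  refine ⟨eval (bar q t v) f / eval (bar q t v) g, sub_eq_zero.mp ?_⟩
  refine eq_zero_of_eval_bar_eq_zero hqt hv (Submodule.sub_mem _ hf (Submodule.smul_mem _ _ hg)) ?_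
  rw [map_sub, smul_eval, div_mul_cancel₀ _ hgv, sub_self]

theorem exists_eq_C_of_mem_interpLine_zero (hf : f ∈ interpLine q t 0) : ∃ c, f = C c :=
  ⟨_, totalDegree_eq_zero_iff_eq_C.mp (by simpa using hf.1)⟩

theorem isInterp_iff_mem_interpLine {α : Fin n → ℕ} {P : MvPolynomial (Fin n) k} :
    IsInterp q t α P ↔ P ∈ interpLine q t (fun i => (α i : ℤ)) ∧
      coeff (Finsupp.equivFunOnFinite.symm α) P = 1 := by
  have hsum : (∑ i, (α i : ℤ)).toNat = ∑ i, α i := by rw [← Nat.cast_sum, Int.toNat_natCast]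
  rw [IsInterp, ← and_assoc]
  refine and_congr_left fun _ => and_congr (by rw [hsum]) ⟨fun h w hw hle hne => ?_,
    fun h β hβ hne => h _ (fun i => by simp) (by beta_reduce; exact_mod_cast hβ)
      fun heq => hne ?_⟩
  · lift w to Fin n → ℕ using hw
    exact h w (by beta_reduce at hle; exact_mod_cast hle) fun heq => hne (by rw [heq])
  · exact funext fun i => Int.ofNat_inj.mp (congrFun heq i)

theorem IsInterp.unique (hqt : Generic q t) {α : Fin n → ℕ} {P Q : MvPolynomial (Fin n) k}
    (hP : IsInterp q t α P) (hQ : IsInterp q t α Q) : P = Q := by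
  rw [isInterp_iff_mem_interpLine] at hP hQ
  obtain ⟨c, rfl⟩ := exists_eq_smul hqt (fun i => by simp) hP.1 hQ.1
    (fun h => by simp [h] at hQ)
  have hc : c = 1 := by simpa [hQ.2] using hP.2
  rw [hc, one_smul]

theorem eval_bar_hecke (ht : t ≠ 0) {i j : Fin n} (hij : (j : ℕ) = i + 1) (w : Fin n → ℤ)
    (f : MvPolynomial (Fin n) k) :
    (bar q t w i - bar q t w j) * eval (bar q t w) (hecke t i j f) =
      (t - 1) * bar q t w i * eval (bar q t w) f +
        (bar q t w i - t * bar q t w j) * eval (bar q t (w ∘ Equiv.swap i j)) f := by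
  rw [eval_hecke]
  by_cases h : w i = w j
  · rw [bar_of_eq ht hij h, sub_self, zero_mul, zero_mul]
  · rw [bar_comp_swap hij h]

theorem hecke_smul_sub_mem_interpLine (hqt : Generic q t) (ht : t ≠ 1) {i j : Fin n}
    (hij : (j : ℕ) = i + 1) (hf : f ∈ interpLine q t v) :
    (bar q t v i - bar q t v j) • hecke t i j f - ((t - 1) * bar q t v i) • f ∈
      interpLine q t (v ∘ Equiv.swap i j) := by
  have hdeg : f.totalDegree ≤ (∑ l, (v ∘ Equiv.swap i j) l).toNat := by
    rw [sum_comp_swap]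
    exact hf.1
  refine ⟨(totalDegree_sub _ _).trans (max_le ?_ ((totalDegree_smul_le _ _).trans hdeg)),
    fun w hw hle hne => ?_⟩
  · refine (totalDegree_smul_le _ _).trans ((totalDegree_hecke_le ?_ f).trans hdeg)
    rintro rfl
    omega
  rw [sum_comp_swap] at hle
  have h := eval_bar_hecke (q := q) hqt.t_ne hij w f
  have hswap : (bar q t w i - t * bar q t w j) * eval (bar q t (w ∘ Equiv.swap i j)) f = 0 := by
    by_cases hwij : w i = w j
    · rw [bar_of_eq hqt.t_ne hij hwij, sub_self, zero_mul]
    · rw [hf.2 (w ∘ Equiv.swap i j) (fun _ => hw _) (by rwa [sum_comp_swap]), mul_zero]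
      rintro rfl
      exact hne (comp_swap_swap w i j).symm
  rw [hswap, add_zero] at h
  rw [map_sub, smul_eval, smul_eval]
  by_cases hwv : w = v
  · rw [← hwv, h, sub_self]
  · rw [hf.2 w hw hle hwv] at h ⊢
    rw [mul_zero] at h
    rw [(mul_eq_zero.mp h).resolve_left (hqt.bar_sub_ne_zero ht w hij)]
    ring

theorem raise_mem_interpLine {v : Fin (n + 1) → ℤ} {f : MvPolynomial (Fin (n + 1)) k}
    (hq : q ≠ 0) (hv : 0 ≤ v) (hf : f ∈ interpLine q t v) :
    raise q t f ∈ interpLine q t (rot v) := by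
  refine ⟨(totalDegree_raise_le f).trans ?_, fun w hw hle hne => ?_⟩
  · have := Finset.sum_nonneg fun i (_ : i ∈ Finset.univ) => hv i
    have := hf.1
    rw [sum_rot]
    omega
  refine eval_bar_raise_eq_zero hq hw fun u hu huw => ?_
  rw [← huw, sum_rot, sum_rot, add_le_add_iff_right] at hle
  exact hf.2 u hu hle fun h => hne (by rw [← huw, h])

end InterpLine

/-! ### Existence of interpolation polynomials -/

section ProdInterp

variable {k : Type*} [Field k] {q : k} {n : ℕ}

/-- The interpolation polynomial `∏_i ∏_{j < α_i} (x_i - q ^ j)` for `t = 1`. -/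
def prodInterp (q : k) (α : Fin n → ℕ) : MvPolynomial (Fin n) k :=
  ∏ i, ∏ j ∈ Finset.range (α i), (X i - C (q ^ j))

theorem totalDegree_prodInterp_le (q : k) (α : Fin n → ℕ) :
    (prodInterp q α).totalDegree ≤ ∑ i, α i := by
  refine (totalDegree_finsetProd _ _).trans (Finset.sum_le_sum fun i _ => ?_)
  refine (totalDegree_finsetProd _ _).trans ?_
  simp only [totalDegree_X_sub_C, Finset.sum_const, Finset.card_range, smul_eq_mul, mul_one, le_rfl]

theorem lex_degree_prodInterp (q : k) (α : Fin n → ℕ) :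
    MonomialOrder.lex.degree (prodInterp q α) = Finsupp.equivFunOnFinite.symm α := by
  have hne (i : Fin n) (j : ℕ) : X i - C (q ^ j) ≠ 0 := X_sub_C_ne_zero _ _
  rw [prodInterp, MonomialOrder.degree_prod fun i _ =>
    Finset.prod_ne_zero_iff.mpr fun j _ => hne i j]
  simp only [MonomialOrder.degree_prod fun j _ => hne _ j, MonomialOrder.degree_X_sub_C]
  ext i
  simp [Finsupp.finsetSum_apply, Finsupp.single_apply]

theorem coeff_prodInterp (q : k) (α : Fin n → ℕ) :
    coeff (Finsupp.equivFunOnFinite.symm α) (prodInterp q α) = 1 := by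
  rw [← lex_degree_prodInterp q α]
  exact MonomialOrder.Monic.prod fun i _ => MonomialOrder.Monic.prod fun j _ =>
    MonomialOrder.monic_X_sub_C _ i (q ^ j)

theorem eval_prodInterp_eq_zero {α β : Fin n → ℕ} (hβ : ∑ i, β i ≤ ∑ i, α i) (hne : β ≠ α) :
    eval (bar q 1 fun i => (β i : ℤ)) (prodInterp q α) = 0 := by
  obtain ⟨i, hi⟩ : ∃ i, β i < α i := by
    by_contra! h
    exact hne (funext fun i => le_antisymm
      ((Finset.sum_eq_sum_iff_of_le fun i _ => h i).mp
        (hβ.antisymm' (Finset.sum_le_sum fun i _ => h i)) i (Finset.mem_univ i)).ge (h i))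
  simp only [prodInterp, map_prod]
  refine Finset.prod_eq_zero (Finset.mem_univ i) (Finset.prod_eq_zero (Finset.mem_range.mpr hi) ?_)
  simp [bar]

theorem isInterp_prodInterp (q : k) (α : Fin n → ℕ) : IsInterp q 1 α (prodInterp q α) :=
  ⟨totalDegree_prodInterp_le q α, fun _ h h' => eval_prodInterp_eq_zero h h', coeff_prodInterp q α⟩

end ProdInterp

section Specialization

variable {R K k σ : Type*} [CommRing R] [Field K] [Field k]

theorem exists_mulVec_map_eq {m : Type*} [Fintype m] {ι : R →+* K}
    (hι : Function.Injective ι) (φ : R →+* k) {M : Matrix m m R}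
    (hM : ∀ c, (M.map φ).mulVec c = 0 → c = 0) (b : m → K) : ∃ c, (M.map ι).mulVec c = b := by
  classical
  -- The determinant over `R` is nonzero because its image under `φ` is.
  have hdet : M.det ≠ 0 := by
    intro h
    have h' : (M.map φ).det = 0 := by
      rw [← RingHom.mapMatrix_apply, ← RingHom.map_det, h, map_zero]
    obtain ⟨c, hc, hc'⟩ := Matrix.exists_mulVec_eq_zero_iff.mpr h'
    exact hc (hM c hc')
  have hunit : IsUnit (M.map ι).det := by
    rw [← RingHom.mapMatrix_apply, ← RingHom.map_det]
    exact ((map_ne_zero_iff ι hι).mpr hdet).isUnit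
  refine ⟨(M.map ι)⁻¹.mulVec b, ?_⟩
  rw [Matrix.mulVec_mulVec, Matrix.mul_nonsing_inv _ hunit, Matrix.one_mulVec]

/-- The polynomial supported on `S` with coefficients `c`. -/
def ofCoeffs {S : Finset (σ →₀ ℕ)} (c : S → R) : MvPolynomial σ R :=
  ∑ γ : S, monomial γ (c γ)

variable {S : Finset (σ →₀ ℕ)}

theorem ofCoeffs_mem_restrictSupport (c : S → R) : ofCoeffs c ∈ restrictSupport R (S : Set _) :=
  Submodule.sum_mem _ fun γ _ => (monomial_mem_restrictSupport R).mpr (Or.inl γ.2)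

theorem coeff_ofCoeffs (c : S → R) (γ : S) : coeff γ (ofCoeffs c) = c γ := by
  classical
  simp [ofCoeffs, coeff_sum, coeff_monomial]

open Classical in
/-- The matrix, in the basis of monomials, of the linear map which sends a polynomial supported on
`S` to its coefficient at `α` and its values at the points `y β` with `β ≠ α`. -/
def interpMatrix (y : (σ →₀ ℕ) → σ → R) (α : S) : Matrix S S R := fun β γ =>
  if β = α then (Pi.single α 1 : S → R) γ else γ.1.prod fun i e => y β i ^ e

theorem map_interpMatrix_mulVec_self (φ : R →+* k) (y : (σ →₀ ℕ) → σ → R) (α : S) (c : S → k) :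
    ((interpMatrix y α).map φ).mulVec c α = coeff α (ofCoeffs c) := by
  simp [interpMatrix, Matrix.mulVec, dotProduct, coeff_ofCoeffs, Pi.single_apply]

theorem map_interpMatrix_mulVec_of_ne (φ : R →+* k) (y : (σ →₀ ℕ) → σ → R) {α β : S}
    (h : β ≠ α) (c : S → k) :
    ((interpMatrix y α).map φ).mulVec c β = eval (φ ∘ y β) (ofCoeffs c) := by
  simp [interpMatrix, Matrix.mulVec, dotProduct, ofCoeffs, eval_monomial, h, map_finsuppProd,
    mul_comm]

theorem exists_interpolating_of_specialization {ι : R →+* K} (hι : Function.Injective ι)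
    (φ : R →+* k) (y : (σ →₀ ℕ) → σ → R) {α : σ →₀ ℕ} (hα : α ∈ S)
    (h : ∀ f ∈ restrictSupport k (S : Set (σ →₀ ℕ)), coeff α f = 0 →
      (∀ β ∈ S, β ≠ α → eval (φ ∘ y β) f = 0) → f = 0) :
    ∃ f ∈ restrictSupport K (S : Set (σ →₀ ℕ)), coeff α f = 1 ∧
      ∀ β ∈ S, β ≠ α → eval (ι ∘ y β) f = 0 := by
  classical
  have hker (c : S → k) (hc : ((interpMatrix y ⟨α, hα⟩).map φ).mulVec c = 0) : c = 0 := by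
    have hzero : ofCoeffs c = 0 := by
      refine h _ (ofCoeffs_mem_restrictSupport c) ?_ fun β hβ hne => ?_
      · rw [← map_interpMatrix_mulVec_self φ y ⟨α, hα⟩, hc, Pi.zero_apply]
      · have hne' : (⟨β, hβ⟩ : S) ≠ ⟨α, hα⟩ := fun h => hne (congrArg Subtype.val h)
        rw [← map_interpMatrix_mulVec_of_ne φ y hne', hc, Pi.zero_apply]
    funext γ
    rw [← coeff_ofCoeffs c γ, hzero, coeff_zero, Pi.zero_apply]
  obtain ⟨c, hc⟩ := exists_mulVec_map_eq hι φ hker (Pi.single ⟨α, hα⟩ 1)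
  refine ⟨ofCoeffs c, ofCoeffs_mem_restrictSupport c, ?_, fun β hβ hne => ?_⟩
  · rw [← map_interpMatrix_mulVec_self ι y ⟨α, hα⟩, hc, Pi.single_eq_same]
  · have hne' : (⟨β, hβ⟩ : S) ≠ ⟨α, hα⟩ := fun h => hne (congrArg Subtype.val h)
    rw [← map_interpMatrix_mulVec_of_ne ι y hne', hc, Pi.single_eq_of_ne hne']

end Specialization

section BaseField

theorem algebraMap_BaseF_injective :
    Function.Injective (algebraMap (MvPolynomial (Fin 2) ℚ) BaseF) :=
  IsFractionRing.injective _ _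

theorem qF_ne_zero : qF ≠ 0 :=
  (map_ne_zero_iff _ algebraMap_BaseF_injective).mpr (X_ne_zero _)

theorem tF_ne_zero : tF ≠ 0 :=
  (map_ne_zero_iff _ algebraMap_BaseF_injective).mpr (X_ne_zero _)

theorem generic_two_one : Generic (2 : ℚ) 1 where
  q_ne := two_ne_zero
  t_ne := one_ne_zero
  pow_ne m b hm := by
    rw [one_zpow, Ne, zpow_eq_one_iff_right₀ (by norm_num) (by norm_num)]
    exact hm

theorem kIndex_le {n : ℕ} (v : Fin n → ℤ) (i : Fin n) : kIndex v i ≤ n := by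
  rw [kIndex_eq_card]
  exact (Finset.card_filter_le _ _).trans (by simp)

/-- The spectral vector of `β` over `ℚ[q, t]`, multiplied by `t ^ n` to clear denominators. -/
def integralBar {n : ℕ} (β : Fin n →₀ ℕ) (i : Fin n) : MvPolynomial (Fin 2) ℚ :=
  X 0 ^ β i * X 1 ^ (n - kIndex (fun i => (β i : ℤ)) i)

theorem map_integralBar {k : Type*} [Field k] (φ : MvPolynomial (Fin 2) ℚ →+* k)
    (hφ : φ (X 1) ≠ 0) {n : ℕ} (β : Fin n →₀ ℕ) :
    φ ∘ integralBar β = φ (X 1) ^ n • bar (φ (X 0)) (φ (X 1)) fun i => (β i : ℤ) := by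
  funext i
  simp only [integralBar, bar, Function.comp_apply, map_mul, map_pow, Pi.smul_apply, smul_eq_mul,
    zpow_natCast, zpow_neg, pow_sub₀ _ hφ (kIndex_le _ i)]
  ring

theorem IsInterp.eq_zero_of_coeff_eq_zero {k : Type*} [Field k] {q t : k} (hqt : Generic q t)
    {n : ℕ} {α : Fin n → ℕ} {P f : MvPolynomial (Fin n) k} (hP : IsInterp q t α P)
    (hf : f ∈ interpLine q t fun i => (α i : ℤ))
    (h : coeff (Finsupp.equivFunOnFinite.symm α) f = 0) : f = 0 := by
  rw [isInterp_iff_mem_interpLine] at hP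
  obtain ⟨c, rfl⟩ := exists_eq_smul hqt (fun i => by simp) hf hP.1 fun h => by simp [h] at hP
  rw [coeff_smul, hP.2, smul_eq_mul, mul_one] at h
  rw [h, zero_smul]

theorem scaleVars_mem_interpLine {k : Type*} [Field k] (φ : MvPolynomial (Fin 2) ℚ →+* k)
    (hφ : φ (X 1) ≠ 0) {n : ℕ} {α : Fin n →₀ ℕ} {f : MvPolynomial (Fin n) k}
    (hf : f.totalDegree ≤ ∑ i, α i)
    (h : ∀ β : Fin n →₀ ℕ, ∑ i, β i ≤ ∑ i, α i → β ≠ α → eval (φ ∘ integralBar β) f = 0) :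
    scaleVars (fun _ => φ (X 1) ^ n) f ∈
      interpLine (φ (X 0)) (φ (X 1)) fun i => (α i : ℤ) := by
  refine ⟨?_, fun w hw hle hne => ?_⟩
  · rw [← Nat.cast_sum, Int.toNat_natCast]
    exact (totalDegree_scaleVars_le _ f).trans hf
  · lift w to Fin n → ℕ using hw
    have hw := h (Finsupp.equivFunOnFinite.symm w) (by beta_reduce at hle; exact_mod_cast hle)
      fun h => hne (by rw [← h]; rfl)
    rw [map_integralBar φ hφ] at hw
    rw [eval_scaleVars]
    exact hw

theorem exists_isInterp {n : ℕ} (α : Fin n → ℕ) : ∃ P, IsInterp qF tF α P := by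
  set γ := Finsupp.equivFunOnFinite.symm α
  have hfin := Finsupp.finite_of_degree_le (σ := Fin n) (∑ i, α i)
  have mem_iff (β : Fin n →₀ ℕ) : β ∈ hfin.toFinset ↔ ∑ i, β i ≤ ∑ i, α i := by
    rw [Set.Finite.mem_toFinset, Set.mem_ofPred_eq, Finsupp.degree_eq_sum]
  have totalDegree_le {k : Type} [Field k] {f : MvPolynomial (Fin n) k}
      (hf : f ∈ restrictSupport k (hfin.toFinset : Set (Fin n →₀ ℕ))) :
      f.totalDegree ≤ ∑ i, α i := by
    rw [Set.Finite.coe_toFinset] at hf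
    exact (mem_restrictTotalDegree _ _ f).mp hf
  obtain ⟨f, hf, hcoeff, hzero⟩ := exists_interpolating_of_specialization
    algebraMap_BaseF_injective (eval ![(2 : ℚ), 1]) (integralBar (n := n)) ((mem_iff γ).mpr le_rfl)
    fun f hf hcoeff hzero => by
      have hmem := scaleVars_mem_interpLine (eval ![(2 : ℚ), 1]) (by simp) (α := γ)
        (totalDegree_le hf) fun β hβ hne => hzero β ((mem_iff β).mpr hβ) hne
      simp only [eval_X, Matrix.cons_val_zero, Matrix.cons_val_one, one_pow] at hmem
      rw [← Pi.one_def, scaleVars_one] at hmem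
      exact (isInterp_prodInterp 2 α).eq_zero_of_coeff_eq_zero generic_two_one hmem hcoeff
  have hmem := scaleVars_mem_interpLine (algebraMap (MvPolynomial (Fin 2) ℚ) BaseF) tF_ne_zero
    (α := γ) (totalDegree_le hf) fun β hβ hne => hzero β ((mem_iff β).mpr hβ) hne
  set g := scaleVars (fun _ => algebraMap (MvPolynomial (Fin 2) ℚ) BaseF (X 1) ^ n) f
  have hg : coeff γ g ≠ 0 := by
    rw [coeff_scaleVars, hcoeff, mul_one]
    exact Finset.prod_ne_zero_iff.mpr fun i _ => pow_ne_zero _ (pow_ne_zero _ tF_ne_zero)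
  refine ⟨(coeff γ g)⁻¹ • g, isInterp_iff_mem_interpLine.mpr ⟨Submodule.smul_mem _ _ hmem, ?_⟩⟩
  rw [coeff_smul, smul_eq_mul, inv_mul_cancel₀ hg]

theorem isInterp_polyG {n : ℕ} (α : Fin n → ℕ) : IsInterp qF tF α (polyG α) := by
  rw [polyG, dif_pos (exists_isInterp α)]
  exact (exists_isInterp α).choose_spec

theorem qF_pow_mul_tF_pow_inj {a b c d : ℕ} (h : qF ^ a * tF ^ b = qF ^ c * tF ^ d) :
    a = c ∧ b = d := by
  have monomial_eq (a b : ℕ) : (X 0 ^ a * X 1 ^ b : MvPolynomial (Fin 2) ℚ) =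
      monomial (Finsupp.single 0 a + Finsupp.single 1 b) 1 := by
    rw [X_pow_eq_monomial, X_pow_eq_monomial, monomial_mul, one_mul]
  simp only [qF, tF, ← map_pow, ← map_mul, algebraMap_BaseF_injective.eq_iff, monomial_eq,
    monomial_left_inj (one_ne_zero (α := ℚ))] at h
  exact ⟨by simpa using DFunLike.congr_fun h 0, by simpa using DFunLike.congr_fun h 1⟩

theorem qF_zpow_mul_tF_zpow_eq_one {a b : ℤ} (h : qF ^ a * tF ^ b = 1) : a = 0 ∧ b = 0 := by
  have pow_toNat {x : BaseF} (hx : x ≠ 0) (c : ℤ) : x ^ c.toNat = x ^ (-c).toNat * x ^ c := by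
    rw [← zpow_natCast, ← zpow_natCast, ← zpow_add₀ hx]
    congr 1
    omega
  have hpow : qF ^ a.toNat * tF ^ b.toNat = qF ^ (-a).toNat * tF ^ (-b).toNat := by
    rw [pow_toNat qF_ne_zero, pow_toNat tF_ne_zero, mul_mul_mul_comm, h, mul_one]
  obtain ⟨ha, hb⟩ := qF_pow_mul_tF_pow_inj hpow
  omega

theorem generic_qF_tF : Generic qF tF where
  q_ne := qF_ne_zero
  t_ne := tF_ne_zero
  pow_ne m b hm h := by
    refine hm (qF_zpow_mul_tF_zpow_eq_one (a := m) (b := -b) ?_).1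
    rw [h, ← zpow_add₀ tF_ne_zero, add_neg_cancel, zpow_zero]

theorem isInterp_iff {n : ℕ} (α : Fin n → ℕ) (P : MvPolynomial (Fin n) BaseF) :
    IsInterp qF tF α P ↔ P = polyG α := by
  constructor
  · exact fun h => h.unique generic_qF_tF (isInterp_polyG α)
  · rintro rfl
    exact isInterp_polyG α

end BaseField

/-! ### The Cherednik eigenvalue equation -/

section Cherednik

theorem removeNth_comp_swap {α : Type*} {n : ℕ} (x : Fin (n + 1) → α) (i : Fin n) :
    i.succ.removeNth (x ∘ Equiv.swap i.castSucc i.succ) = i.castSucc.removeNth x := by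
  funext l
  simp only [Fin.removeNth, Function.comp_apply]
  congr 1
  simp only [Fin.succAbove, Equiv.swap_apply_def, Fin.lt_def, Fin.ext_iff]
  split_ifs <;> simp_all <;> omega

variable {k : Type*} [Field k] {q t : k} {n : ℕ}

/-- The polynomial `H_p ⋯ H_{n-1} Φ f`, where `Φ` is the raising operator and `H_i` the Hecke
operator at `i` and `i + 1`. -/
def heckeChain (q t : k) (f : MvPolynomial (Fin (n + 1)) k) (p : Fin (n + 1)) :
    MvPolynomial (Fin (n + 1)) k :=
  Fin.reverseInduction (motive := fun _ => MvPolynomial (Fin (n + 1)) k) (raise q t f)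
    (fun i => hecke t i.castSucc i.succ) p

theorem heckeChain_last (f : MvPolynomial (Fin (n + 1)) k) :
    heckeChain q t f (Fin.last n) = raise q t f :=
  Fin.reverseInduction_last

theorem heckeChain_castSucc (f : MvPolynomial (Fin (n + 1)) k) (i : Fin n) :
    heckeChain q t f i.castSucc = hecke t i.castSucc i.succ (heckeChain q t f i.succ) :=
  Fin.reverseInduction_castSucc i

theorem totalDegree_heckeChain_le (f : MvPolynomial (Fin (n + 1)) k) (p : Fin (n + 1)) :
    (heckeChain q t f p).totalDegree ≤ f.totalDegree + 1 := by
  induction p using Fin.reverseInduction with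
  | last => rw [heckeChain_last]; exact totalDegree_raise_le f
  | cast i ih =>
    rw [heckeChain_castSucc]
    exact (totalDegree_hecke_le Fin.castSucc_lt_succ.ne _).trans ih

theorem vanishesUpTo_heckeChain (hqt : Generic q t) (ht : t ≠ 1) {d : ℕ}
    {f : MvPolynomial (Fin (n + 1)) k}
    (hf : ∀ v : Fin (n + 1) → ℤ, 0 ≤ v → ∑ i, v i < d → eval (bar q t v) f = 0) (p : Fin (n + 1)) :
    VanishesUpTo q t d (heckeChain q t f p) := by
  induction p using Fin.reverseInduction with
  | last =>
    intro w hw hd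
    rw [heckeChain_last]
    refine eval_bar_raise_eq_zero hqt.q_ne hw fun u hu huw => hf u hu ?_
    rw [← huw, sum_rot] at hd
    omega
  | cast i ih =>
    intro w hw hd
    have hij : ((i.succ : Fin (n + 1)) : ℕ) = i.castSucc + 1 := rfl
    have h := eval_bar_hecke (q := q) hqt.t_ne hij w (heckeChain q t f i.succ)
    rw [ih w hw hd, ih (w ∘ Equiv.swap i.castSucc i.succ) (fun _ => hw _)
      (by rwa [sum_comp_swap]), mul_zero, mul_zero, add_zero] at h
    rw [heckeChain_castSucc]
    exact (mul_eq_zero.mp h).resolve_left (hqt.bar_sub_ne_zero ht w hij)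

theorem tau_apply_zero : tau t (n + 1) 0 = 1 := by
  simp [tau]

theorem eval_smul_tau_heckeChain (ht0 : t ≠ 0) (ht : t ≠ 1) {z : k} (hz : z ≠ 0)
    (f : MvPolynomial (Fin (n + 1)) k) (p : Fin (n + 1)) :
    eval (z • tau t (n + 1)) (heckeChain q t f p) =
      tau t (n + 1) p * (z - 1) * eval (unrot q (z • tau t (n + 1))) f := by
  induction p using Fin.reverseInduction with
  | last =>
    rw [heckeChain_last, eval_raise]
    simp only [tau, Pi.smul_apply, smul_eq_mul, Fin.val_last]
    ring
  | cast i ih =>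
    have htau : tau t (n + 1) i.castSucc = t * tau t (n + 1) i.succ := tau_of_adj ht0 rfl
    rw [heckeChain_castSucc, eval_hecke_of_eq_mul ht, ih, htau]
    · ring
    · simp only [Pi.smul_apply, smul_eq_mul, htau, mul_left_comm]
    · exact mul_ne_zero hz (tau_ne_zero ht0 _)

theorem eval_heckeChain_of_eq_zero (ht : t ≠ 0) (f : MvPolynomial (Fin (n + 1)) k) (p : Fin (n + 1))
    {x : Fin (n + 1) → k} (hx : x p = 0) : eval x (heckeChain q t f p) =
      -tau t (n + 1) p * eval (Fin.cons (α := fun _ => k) (x p) (p.removeNth x)) f := by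
  induction p using Fin.reverseInduction generalizing x with
  | last =>
    rw [heckeChain_last, eval_raise, hx, zero_sub]
    congr 3
    funext l
    refine Fin.cases ?_ (fun l => ?_) l
    · simp [hx]
    · simp [Fin.init]
  | cast i ih =>
    have hx' : (x ∘ Equiv.swap i.castSucc i.succ) i.succ = x i.castSucc := by simp
    rw [heckeChain_castSucc, eval_hecke_of_eq_zero _ hx, ih (hx'.trans hx), hx',
      removeNth_comp_swap, tau_of_adj ht (i := i.castSucc) (j := i.succ) rfl]
    ring

theorem Generic.infinite (hqt : Generic q t) : Infinite k := by
  refine Infinite.of_injective (fun m : ℤ => q ^ m) fun a b h => ?_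
  by_contra hab
  refine hqt.pow_ne (a - b) 0 (sub_ne_zero.mpr hab) ?_
  rw [zpow_sub₀ hqt.q_ne, zpow_zero, div_eq_one_iff_eq (zpow_ne_zero _ hqt.q_ne)]
  exact h

theorem X_dvd_of_eval_eq_zero {σ : Type*} [Infinite k] {i : σ} {f : MvPolynomial σ k}
    (h : ∀ x : σ → k, x i = 0 → eval x f = 0) : X i ∣ f := by
  classical
  have hdvd := dvd_sub_bind₁ (p := X i) (g := Function.update X i 0) (fun j => ?_) f
  · have hzero : bind₁ (Function.update X i 0) f = 0 := by
      refine MvPolynomial.funext fun x => ?_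
      rw [eval_bind₁, h _ (by simp), map_zero]
    rwa [hzero, sub_zero] at hdvd
  · obtain rfl | hj := eq_or_ne j i <;> simp [*]

/-- The eigenvalue equation for the inhomogeneous Cherednik operator
`f ↦ x_1⁻¹ (f + H_1 ⋯ H_{n-1} Φ f)`, with the denominator cleared. -/
theorem add_heckeChain_eq_smul (hqt : Generic q t) (ht : t ≠ 1) {v : Fin (n + 1) → ℤ} (hv : 0 ≤ v)
    {f : MvPolynomial (Fin (n + 1)) k} (hf : f ∈ interpLine q t v) :
    f + heckeChain q t f 0 = (bar q t v 0)⁻¹ • (X 0 * f) := by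
  have := hqt.infinite
  obtain ⟨d, hd⟩ : ∃ d : ℕ, ∑ i, v i = d :=
    Int.eq_ofNat_of_zero_le (Finset.sum_nonneg fun i _ => hv i)
  have hdeg : f.totalDegree ≤ d := by simpa [hd] using hf.1
  set D := f + heckeChain q t f 0 - (bar q t v 0)⁻¹ • (X 0 * f) with hD
  have hDdeg : D.totalDegree ≤ d + 1 := by
    refine (totalDegree_sub _ _).trans (max_le ((totalDegree_add _ _).trans (max_le ?_ ?_)) ?_)
    · omega
    · exact (totalDegree_heckeChain_le f 0).trans (by omega)
    · refine (totalDegree_smul_le _ _).trans ((totalDegree_mul _ _).trans ?_)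
      rw [totalDegree_X]
      omega
  have hDvanish : VanishesUpTo q t d D := fun w hw hwd => by
    have hchain := vanishesUpTo_heckeChain hqt ht (d := d) (f := f)
      (fun u hu hud => hf.2 u hu (by omega) (by rintro rfl; omega)) 0 w hw hwd
    simp only [hD, map_sub, map_add, smul_eval, map_mul, eval_X, hchain, add_zero]
    by_cases hwv : w = v
    · rw [hwv, inv_mul_cancel_left₀ (bar_ne_zero hqt.q_ne hqt.t_ne v 0), sub_self]
    · rw [hf.2 w hw (hd ▸ hwd) hwv, mul_zero, mul_zero, sub_zero]
  obtain ⟨E, hE⟩ : X 0 ∣ D := X_dvd_of_eval_eq_zero fun x hx => by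
    have hcons : Fin.cons (α := fun _ => k) (x 0) (Fin.removeNth 0 x) = x := Fin.cons_self_tail x
    rw [hD, map_sub, map_add, eval_heckeChain_of_eq_zero hqt.t_ne f 0 hx, hcons, smul_eval,
      map_mul, eval_X, hx, tau_apply_zero]
    ring
  have hEzero : E = 0 := by
    by_contra hne
    refine hne (VanishesUpTo.eq_zero hqt (d := d) (fun w hw hwd => ?_) ?_)
    · have h := hDvanish w hw hwd
      rw [hE, map_mul, eval_X] at h
      exact (mul_eq_zero.mp h).resolve_left (bar_ne_zero hqt.q_ne hqt.t_ne w 0)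
    · rw [hE, totalDegree_mul_of_isDomain (X_ne_zero _) hne, totalDegree_X] at hDdeg
      omega
  rw [← sub_eq_zero, ← hD, hE, hEzero, mul_zero]

theorem eval_unrot_smul_tau (hqt : Generic q t) (ht : t ≠ 1) {v : Fin (n + 1) → ℤ} (hv : 0 ≤ v)
    {f : MvPolynomial (Fin (n + 1)) k} (hf : f ∈ interpLine q t v) {z : k} (hz : z ≠ 0) :
    (z - 1) * eval (unrot q (z • tau t (n + 1))) f =
      (z * (bar q t v 0)⁻¹ - 1) * eval (z • tau t (n + 1)) f := by
  have h := congrArg (eval (z • tau t (n + 1))) (add_heckeChain_eq_smul hqt ht hv hf)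
  simp only [map_add, eval_smul_tau_heckeChain hqt.t_ne ht hz, smul_eval, map_mul, eval_X,
    Pi.smul_apply, smul_eq_mul, tau_apply_zero] at h
  linear_combination h

end Cherednik

/-! ### Normalised interpolation polynomials -/

section Normalized

variable {k : Type*} [Field k] {q t a : k}

/-- The conditions on the parameters `q`, `t` and `a` under which the interpolation polynomials can
be normalised at `a τ` and extended to integral vectors. -/
structure GenericTriple (q t a : k) : Prop extends Generic q t where
  t_ne_one : t ≠ 1
  a_ne : a ≠ 0
  a_mul_ne : ∀ m b : ℤ, a * (q ^ m * t ^ b) ≠ 1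

theorem GenericTriple.one_sub_mul_bar_inv_ne_zero (h : GenericTriple q t a) {n : ℕ} (m : ℤ)
    (v : Fin n → ℤ) (i : Fin n) : 1 - q ^ m * a * (bar q t v i)⁻¹ ≠ 0 := by
  intro heq
  refine h.a_mul_ne (m - v i) (kIndex v i) ?_
  rw [zpow_sub₀ h.q_ne]
  rw [bar, mul_inv, ← zpow_neg, ← zpow_neg, neg_neg, zpow_neg] at heq
  linear_combination -heq

theorem GenericTriple.one_sub_bar_inv_ne_zero (h : GenericTriple q t a) {n : ℕ} (v : Fin n → ℤ)
    (i : Fin n) : 1 - a * (bar q t v i)⁻¹ ≠ 0 := by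
  simpa using h.one_sub_mul_bar_inv_ne_zero 0 v i

theorem Generic.bar_sub_mul_bar_ne_zero (h : Generic q t) {n : ℕ} {v : Fin n → ℤ} {i j : Fin n}
    (hv : v i ≠ v j) : bar q t v i - t * bar q t v j ≠ 0 := by
  simpa [sub_ne_zero] using h.bar_ne_of_ne hv 1

variable {n : ℕ}

theorem eval_smul_tau_hecke_sub (ht0 : t ≠ 0) (ht : t ≠ 1) (ha : a ≠ 0) {i j : Fin n}
    (hij : (j : ℕ) = i + 1) (v : Fin n → ℤ) (f : MvPolynomial (Fin n) k) :
    eval (a • tau t n)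
      ((bar q t v i - bar q t v j) • hecke t i j f - ((t - 1) * bar q t v i) • f) =
      (bar q t v i - t * bar q t v j) * eval (a • tau t n) f := by
  have hτ : (a • tau t n) i = t * (a • tau t n) j := by
    simp only [Pi.smul_apply, smul_eq_mul, tau_of_adj ht0 hij, mul_left_comm]
  rw [map_sub, smul_eval, smul_eval,
    eval_hecke_of_eq_mul ht f hτ (mul_ne_zero ha (tau_ne_zero ht0 j))]
  ring

theorem eval_smul_tilde_hecke (hq : q ≠ 0) (ht : t ≠ 0) (ha : a ≠ 0) {i j : Fin n}
    (hij : (j : ℕ) = i + 1) (u : Fin n → ℤ) (f : MvPolynomial (Fin n) k) :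
    (bar q t u j.rev - bar q t u i.rev) * eval (a • tilde q t u) (hecke t i j f) =
      (t - 1) * bar q t u j.rev * eval (a • tilde q t u) f +
        (bar q t u j.rev - t * bar q t u i.rev) *
          eval (a • tilde q t (u ∘ Equiv.swap j.rev i.rev)) f := by
  have hij' : (i.rev : ℕ) = j.rev + 1 := by
    simp only [Fin.val_rev]
    omega
  have hheck := eval_hecke (t := t) (i := i) (j := j) f (a • tilde q t u)
  simp only [Pi.smul_apply, smul_eq_mul, tilde_eq ht u] at hheck
  have hswap : (bar q t u j.rev - t * bar q t u i.rev) *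
      eval (a • tilde q t (u ∘ Equiv.swap j.rev i.rev)) f =
      (bar q t u j.rev - t * bar q t u i.rev) *
        eval ((a • tilde q t u) ∘ Equiv.swap i j) f := by
    by_cases hu : u j.rev = u i.rev
    · rw [bar_of_eq ht hij' hu, sub_self, zero_mul, zero_mul]
    · rw [tilde_comp_swap hij' hu, Fin.rev_rev, Fin.rev_rev]
      rfl
  rw [hswap]
  have hi := bar_ne_zero hq ht u i.rev
  have hj := bar_ne_zero hq ht u j.rev
  have hn := zpow_ne_zero (1 - (n : ℤ)) ht
  field_simp at hheck
  linear_combination hheck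

theorem eval_smul_tau_raise (hqt : Generic q t) (ht : t ≠ 1) {v : Fin (n + 1) → ℤ} (hv : 0 ≤ v)
    {f : MvPolynomial (Fin (n + 1)) k} (hf : f ∈ interpLine q t v) {z : k} (hz : z ≠ 0) :
    eval (z • tau t (n + 1)) (raise q t f) =
      -t ^ (-(n : ℤ)) * (1 - z * (bar q t v 0)⁻¹) * eval (z • tau t (n + 1)) f := by
  have h := eval_unrot_smul_tau hqt ht hv hf hz
  rw [eval_raise, Pi.smul_apply, smul_eq_mul, tau, Fin.val_last]
  linear_combination t ^ (-(n : ℤ)) * h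

theorem eval_smul_tau_ne_zero (h : GenericTriple q t a)
    {g : (Fin n → ℤ) → MvPolynomial (Fin n) k} (hg : ∀ v, 0 ≤ v → g v ∈ interpLine q t v)
    (hg0 : ∀ v, 0 ≤ v → g v ≠ 0) {v : Fin n → ℤ} (hv : 0 ≤ v) :
    eval (a • tau t n) (g v) ≠ 0 := by
  have hzero : eval (a • tau t n) (g 0) ≠ 0 := by
    obtain ⟨c, hc⟩ := exists_eq_C_of_mem_interpLine_zero (hg 0 le_rfl)
    rw [hc, eval_C]
    exact fun h0 => hg0 0 le_rfl (by rw [hc, h0, C_0])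
  cases n with
  | zero => rwa [Subsingleton.elim v 0]
  | succ n =>
    refine nonneg_induction (P := fun v => eval (a • tau t (n + 1)) (g v) ≠ 0) hzero
      (fun v hv i j hij hvij ih => ?swap) (fun v hv ih => ?rotate) hv
    case swap =>
      obtain ⟨c, hc⟩ := exists_eq_smul h.toGeneric (v := v ∘ Equiv.swap i j) (fun _ => hv _)
        (hecke_smul_sub_mem_interpLine h.toGeneric h.t_ne_one hij (hg v hv))
        (hg _ fun _ => hv _) (hg0 _ fun _ => hv _)
      have heval := eval_smul_tau_hecke_sub (q := q) h.t_ne h.t_ne_one h.a_ne hij v (g v)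
      rw [hc, smul_eval] at heval
      exact right_ne_zero_of_mul
        (heval ▸ mul_ne_zero (h.bar_sub_mul_bar_ne_zero hvij) ih)
    case rotate =>
      obtain ⟨c, hc⟩ := exists_eq_smul h.toGeneric (rot_nonneg hv)
        (raise_mem_interpLine h.q_ne hv (hg v hv)) (hg _ (rot_nonneg hv)) (hg0 _ (rot_nonneg hv))
      have heval := eval_smul_tau_raise h.toGeneric h.t_ne_one hv (hg v hv) h.a_ne
      rw [hc, smul_eval] at heval
      exact right_ne_zero_of_mul (heval ▸ mul_ne_zero (mul_ne_zero
        (neg_ne_zero.mpr (zpow_ne_zero _ h.t_ne)) (h.one_sub_bar_inv_ne_zero v 0)) ih)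

/-- A family of interpolation polynomials, indexed by compositions, which take the value `1` at
`a τ`. The members at vectors with a negative entry are arbitrary. -/
structure IsNormalizedFamily (q t a : k) (E : (Fin n → ℤ) → MvPolynomial (Fin n) k) : Prop where
  mem_interpLine : ∀ v, 0 ≤ v → E v ∈ interpLine q t v
  eval_smul_tau : ∀ v, 0 ≤ v → eval (a • tau t n) (E v) = 1

namespace IsNormalizedFamily

section

variable {E : (Fin n → ℤ) → MvPolynomial (Fin n) k} {v : Fin n → ℤ}

theorem eq_smul (hE : IsNormalizedFamily q t a E) (hqt : Generic q t) (hv : 0 ≤ v)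
    {f : MvPolynomial (Fin n) k} (hf : f ∈ interpLine q t v) :
    f = eval (a • tau t n) f • E v := by
  obtain ⟨c, rfl⟩ := exists_eq_smul hqt hv hf (hE.mem_interpLine v hv) fun h0 => by
    simpa [h0] using hE.eval_smul_tau v hv
  rw [smul_eval, hE.eval_smul_tau v hv, mul_one]

theorem hecke_eq (hE : IsNormalizedFamily q t a E) (h : GenericTriple q t a) (hv : 0 ≤ v)
    {i j : Fin n} (hij : (j : ℕ) = i + 1) :
    (bar q t v i - bar q t v j) • hecke t i j (E v) =
      ((t - 1) * bar q t v i) • E v +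
        (bar q t v i - t * bar q t v j) • E (v ∘ Equiv.swap i j) := by
  have heq := hE.eq_smul h.toGeneric (v := v ∘ Equiv.swap i j) (fun _ => hv _)
    (hecke_smul_sub_mem_interpLine h.toGeneric h.t_ne_one hij (hE.mem_interpLine v hv))
  rw [eval_smul_tau_hecke_sub h.t_ne h.t_ne_one h.a_ne hij, hE.eval_smul_tau v hv, mul_one] at heq
  rw [← heq, add_sub_cancel]

theorem hecke_eval (hE : IsNormalizedFamily q t a E) (h : GenericTriple q t a) (hv : 0 ≤ v)
    (u : Fin n → ℤ) {i j : Fin n} (hij : (j : ℕ) = i + 1) :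
    (bar q t u j.rev - bar q t u i.rev) * ((t - 1) * bar q t v i * eval (a • tilde q t u) (E v) +
      (bar q t v i - t * bar q t v j) * eval (a • tilde q t u) (E (v ∘ Equiv.swap i j))) =
    (bar q t v i - bar q t v j) * ((t - 1) * bar q t u j.rev * eval (a • tilde q t u) (E v) +
      (bar q t u j.rev - t * bar q t u i.rev) *
        eval (a • tilde q t (u ∘ Equiv.swap j.rev i.rev)) (E v)) := by
  have hleft := congrArg (eval (a • tilde q t u)) (hE.hecke_eq h hv hij)
  have hright := eval_smul_tilde_hecke h.q_ne h.t_ne h.a_ne hij u (E v)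
  simp only [map_add, smul_eval] at hleft
  linear_combination (bar q t v i - bar q t v j) * hright -
    (bar q t u j.rev - bar q t u i.rev) * hleft

end

variable {E : (Fin (n + 1) → ℤ) → MvPolynomial (Fin (n + 1)) k} {v : Fin (n + 1) → ℤ}

theorem raise_eq (hE : IsNormalizedFamily q t a E) (h : GenericTriple q t a) (hv : 0 ≤ v) :
    raise q t (E v) = (-t ^ (-(n : ℤ)) * (1 - a * (bar q t v 0)⁻¹)) • E (rot v) := by
  rw [hE.eq_smul h.toGeneric (rot_nonneg hv)
    (raise_mem_interpLine h.q_ne hv (hE.mem_interpLine v hv)),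
    eval_smul_tau_raise h.toGeneric h.t_ne_one hv (hE.mem_interpLine v hv) h.a_ne,
    hE.eval_smul_tau v hv, mul_one]

theorem rot_eval (hE : IsNormalizedFamily q t a E) (h : GenericTriple q t a) (hv : 0 ≤ v)
    (x : Fin (n + 1) → k) : (1 - a * (bar q t v 0)⁻¹) * eval x (E (rot v)) =
      (1 - t ^ n * x (Fin.last n)) * eval (unrot q x) (E v) := by
  have heval := congrArg (eval x) (hE.raise_eq h hv)
  rw [eval_raise, smul_eval] at heval
  have := pow_ne_zero n h.t_ne
  rw [zpow_neg, zpow_natCast] at heval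
  field_simp at heval ⊢
  linear_combination heval

theorem rot_eval_smul_tau (hE : IsNormalizedFamily q t a E) (h : GenericTriple q t a) (hv : 0 ≤ v)
    {z : k} (hz : z ≠ 0) : (1 - a * (bar q t v 0)⁻¹) * eval (z • tau t (n + 1)) (E (rot v)) =
      (1 - z * (bar q t v 0)⁻¹) * eval (z • tau t (n + 1)) (E v) := by
  have heval := eval_smul_tau_raise h.toGeneric h.t_ne_one hv (hE.mem_interpLine v hv) hz
  rw [hE.raise_eq h hv, smul_eval] at heval
  apply mul_left_cancel₀ (neg_ne_zero.mpr (zpow_ne_zero (-(n : ℤ)) h.t_ne))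
  linear_combination heval

end IsNormalizedFamily

end Normalized

/-! ### Extension of the evaluations to integral vectors -/

section Shift

variable {k : Type*} [Field k] {q t a : k} {n : ℕ}

theorem qPoch_succ (q y : k) (m : ℕ) : qPoch q y (m + 1) = qPoch q y m * (1 - q ^ m * y) :=
  Finset.prod_range_succ _ m

theorem qPoch_succ' (q y : k) (m : ℕ) : qPoch q y (m + 1) = (1 - y) * qPoch q (q * y) m := by
  simp only [qPoch, Finset.prod_range_succ', pow_zero, one_mul, pow_succ, mul_assoc]
  rw [mul_comm]

/-- The product `∏ (1 - t ^ (n - 1) x_i)`, which relates the interpolation polynomials of `v` and of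
`v + (1 ^ n)`. -/
def poleFactor (t : k) (x : Fin n → k) : k :=
  ∏ i, (1 - t ^ ((n : ℤ) - 1) * x i)

/-- The denominator `∏ (q t ^ (n - 1) x_i; q)_m` of `K_v`. The numerator of its scalar prefactor is
the value of the same product at `a • tilde q t (v + m)`. -/
def polePoch (q t : k) (m : ℕ) (x : Fin n → k) : k :=
  ∏ i, qPoch q (q * t ^ ((n : ℤ) - 1) * x i) m

theorem polePoch_zero (x : Fin n → k) : polePoch q t 0 x = 1 := by
  simp [polePoch, qPoch]

theorem polePoch_succ (m : ℕ) (x : Fin n → k) :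
    polePoch q t (m + 1) x = polePoch q t m x * poleFactor t (q ^ (m + 1) • x) := by
  rw [polePoch, polePoch, poleFactor, ← Finset.prod_mul_distrib]
  refine Finset.prod_congr rfl fun i _ => ?_
  rw [qPoch_succ, Pi.smul_apply, smul_eq_mul]
  ring

theorem polePoch_succ' (m : ℕ) (x : Fin n → k) :
    polePoch q t (m + 1) x = poleFactor t (q • x) * polePoch q t m (q • x) := by
  rw [polePoch, polePoch, poleFactor, ← Finset.prod_mul_distrib]
  refine Finset.prod_congr rfl fun i _ => ?_
  rw [qPoch_succ', Pi.smul_apply, smul_eq_mul]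
  ring_nf

theorem poleFactor_comp_perm (x : Fin n → k) (σ : Equiv.Perm (Fin n)) :
    poleFactor t (x ∘ σ) = poleFactor t x :=
  Equiv.prod_comp σ fun i => 1 - t ^ ((n : ℤ) - 1) * x i

theorem smul_tilde_add_intCast (hq : q ≠ 0) (v : Fin n → ℤ) (c : ℤ) :
    a • tilde q t (v + (c : Fin n → ℤ)) = q ^ (-c) • a • tilde q t v := by
  rw [tilde_add_intCast hq, smul_comm]

theorem smul_tilde_sub_natCast (hq : q ≠ 0) (v : Fin n → ℤ) (m : ℕ) :
    a • tilde q t (v - (m : Fin n → ℤ)) = q ^ m • a • tilde q t v := by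
  have := smul_tilde_add_intCast (t := t) (a := a) hq v (-m)
  rwa [Int.cast_neg, Int.cast_natCast, ← sub_eq_add_neg, neg_neg, zpow_natCast] at this

theorem smul_tilde_sub_one (hq : q ≠ 0) (v : Fin n → ℤ) :
    a • tilde q t (v - 1) = q • a • tilde q t v := by
  simpa using smul_tilde_sub_natCast hq v 1

theorem poleFactor_smul_tilde (ht : t ≠ 0) (v : Fin n → ℤ) :
    poleFactor t (a • tilde q t v) = ∏ i, (1 - a * (bar q t v i)⁻¹) := by
  rw [← Equiv.prod_comp Fin.revPerm]
  refine Finset.prod_congr rfl fun i _ => ?_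
  rw [Pi.smul_apply, smul_eq_mul, tilde_eq ht, mul_left_comm a, ← mul_assoc, ← zpow_add₀ ht,
    sub_add_sub_cancel, sub_self, zpow_zero, one_mul, Fin.revPerm_apply]

theorem pow_mul_smul_tilde_last (ht : t ≠ 0) (v : Fin (n + 1) → ℤ) :
    t ^ n * (a • tilde q t v) (Fin.last n) = a * (bar q t v 0)⁻¹ := by
  rw [Pi.smul_apply, smul_eq_mul, tilde_eq ht, Fin.rev_last, Nat.cast_add_one, sub_add_cancel_right,
    mul_left_comm a, ← mul_assoc, zpow_neg, zpow_natCast, mul_inv_cancel₀ (pow_ne_zero n ht),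
    one_mul]

theorem poleFactor_smul_tilde_comp_swap {i j : Fin n} (hij : (j : ℕ) = i + 1) (v : Fin n → ℤ) :
    poleFactor t (a • tilde q t (v ∘ Equiv.swap i j)) = poleFactor t (a • tilde q t v) := by
  by_cases hv : v i = v j
  · rw [comp_swap_of_eq hv]
  · rw [tilde_comp_swap hij hv]
    exact poleFactor_comp_perm (a • tilde q t v) _

theorem poleFactor_smul_tilde_rot (hq : q ≠ 0) (ht : t ≠ 0) (v : Fin (n + 1) → ℤ) :
    poleFactor t (a • tilde q t (rot v)) * (1 - a * (bar q t v 0)⁻¹) =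
      poleFactor t (a • tilde q t v) * (1 - a * (q * bar q t v 0)⁻¹) := by
  simp only [poleFactor_smul_tilde ht]
  rw [Fin.prod_univ_castSucc, Fin.prod_univ_succ fun i => 1 - a * (bar q t v i)⁻¹,
    bar_rot_last hq]
  simp only [bar_rot_castSucc]
  ring

theorem GenericTriple.poleFactor_ne_zero (h : GenericTriple q t a) (v : Fin n → ℤ) :
    poleFactor t (a • tilde q t v) ≠ 0 := by
  rw [poleFactor_smul_tilde h.t_ne]
  exact Finset.prod_ne_zero_iff.mpr fun i _ => h.one_sub_bar_inv_ne_zero v i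

theorem GenericTriple.polePoch_ne_zero (h : GenericTriple q t a) (m : ℕ) (v : Fin n → ℤ) :
    polePoch q t m (a • tilde q t v) ≠ 0 := by
  induction m generalizing v with
  | zero => simp [polePoch_zero]
  | succ m ih =>
    rw [polePoch_succ', ← smul_tilde_sub_one h.q_ne]
    exact mul_ne_zero (h.poleFactor_ne_zero _) (ih _)

theorem prod_mul_rot_iterate {H : (Fin (n + 1) → ℤ) → (Fin (n + 1) → k) → k}
    {c : (Fin (n + 1) → ℤ) → k} {d : k → k}
    (hH : ∀ v, 0 ≤ v → ∀ x, c v * H (rot v) x = d (x (Fin.last n)) * H v (unrot q x))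
    {v : Fin (n + 1) → ℤ} (hv : 0 ≤ v) (m : ℕ) (x : Fin (n + 1) → k) :
    (∏ j ∈ Finset.range m, c (rot^[j] v)) * H (rot^[m] v) x =
      (∏ j ∈ Finset.range m, d ((unrot q)^[j] x (Fin.last n))) * H v ((unrot q)^[m] x) := by
  induction m generalizing x with
  | zero => simp
  | succ m ih =>
    have hm : 0 ≤ rot^[m] v := Function.Iterate.rec (fun w => 0 ≤ w) hv (fun _ => rot_nonneg) m
    rw [Function.iterate_succ_apply', Finset.prod_range_succ, mul_assoc, hH _ hm, mul_left_comm,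
      ih, Finset.prod_range_succ']
    simp only [Function.iterate_succ_apply, Function.iterate_zero, id_eq]
    ring

theorem prod_mul_add_one {H : (Fin (n + 1) → ℤ) → (Fin (n + 1) → k) → k}
    {c : (Fin (n + 1) → ℤ) → k} {d : k → k}
    (hH : ∀ v, 0 ≤ v → ∀ x, c v * H (rot v) x = d (x (Fin.last n)) * H v (unrot q x))
    {v : Fin (n + 1) → ℤ} (hv : 0 ≤ v) (x : Fin (n + 1) → k) :
    (∏ i : Fin (n + 1), c (rot^[i] v)) * H (v + 1) x = (∏ i, d (x i)) * H v (q⁻¹ • x) := by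
  have h := prod_mul_rot_iterate hH hv (n + 1) x
  rw [rot_iterate, unrot_iterate, Finset.prod_range, Finset.prod_range] at h
  simp only [unrot_iterate_last] at h
  have hrev := Equiv.prod_comp Fin.revPerm fun i => d (x i)
  simp only [Fin.revPerm_apply] at hrev
  rwa [hrev] at h

theorem IsNormalizedFamily.eval_add_one {E : (Fin n → ℤ) → MvPolynomial (Fin n) k}
    (hE : IsNormalizedFamily q t a E) (h : GenericTriple q t a) {v : Fin n → ℤ} (hv : 0 ≤ v)
    (x : Fin n → k) : poleFactor t (a • tilde q t v) * eval x (E (v + 1)) =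
      poleFactor t x * eval (q⁻¹ • x) (E v) := by
  cases n with
  | zero => simp [poleFactor, Subsingleton.elim (v + 1) v, Subsingleton.elim (q⁻¹ • x) x]
  | succ n =>
    have := prod_mul_add_one (H := fun v x => eval x (E v))
      (c := fun v => 1 - a * (bar q t v 0)⁻¹) (d := fun y => 1 - t ^ n * y)
      (fun v hv x => hE.rot_eval h hv x) hv x
    rw [poleFactor_smul_tilde h.t_ne]
    simpa only [bar_rot_iterate_zero, poleFactor, Nat.cast_add, Nat.cast_one,
      add_sub_cancel_right, zpow_natCast] using this

theorem IsNormalizedFamily.polePoch_mul_eval {E : (Fin n → ℤ) → MvPolynomial (Fin n) k}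
    (hE : IsNormalizedFamily q t a E) (h : GenericTriple q t a) {v : Fin n → ℤ} {m : ℕ}
    (hv : 0 ≤ v + (m : Fin n → ℤ)) (x : Fin n → k) :
    polePoch q t (m + 1) (a • tilde q t (v + ((m + 1 : ℕ) : Fin n → ℤ))) *
        eval (q ^ (m + 1) • x) (E (v + ((m + 1 : ℕ) : Fin n → ℤ))) =
      polePoch q t m (a • tilde q t (v + (m : Fin n → ℤ))) *
        eval (q ^ m • x) (E (v + (m : Fin n → ℤ))) * poleFactor t (q ^ (m + 1) • x) := by
  have hstep := hE.eval_add_one h hv (q ^ (m + 1) • x)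
  rw [smul_smul, pow_succ', inv_mul_cancel_left₀ h.q_ne, ← pow_succ'] at hstep
  rw [Nat.cast_add_one, ← add_assoc, polePoch_succ', ← smul_tilde_sub_one h.q_ne,
    add_sub_cancel_right]
  linear_combination polePoch q t m (a • tilde q t (v + (m : Fin n → ℤ))) * hstep

/-- The value at `a ũ` of the function `K_v`, computed from a normalised family `E` with the
shift `v + (m ^ n)`. -/
def extValue (q t a : k) (E : (Fin n → ℤ) → MvPolynomial (Fin n) k) (m : ℕ) (v u : Fin n → ℤ) : k :=
  polePoch q t m (a • tilde q t (v + (m : Fin n → ℤ))) / polePoch q t m (a • tilde q t u) *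
    eval (q ^ m • a • tilde q t u) (E (v + (m : Fin n → ℤ)))

/-- The value `K_v(a ũ)` for a normalised family `E`. -/
def pairing (q t a : k) (E : (Fin n → ℤ) → MvPolynomial (Fin n) k) (v u : Fin n → ℤ) : k :=
  extValue q t a E (minShift v) v u

theorem eq_minShift_of_succ_eq {α : Type*} {f : ℕ → α} {v : Fin n → ℤ}
    (hf : ∀ m : ℕ, 0 ≤ v + (m : Fin n → ℤ) → f (m + 1) = f m) {m : ℕ}
    (hm : 0 ≤ v + (m : Fin n → ℤ)) : f m = f (minShift v) := by
  induction m, add_natCast_nonneg_iff.mp hm using Nat.le_induction with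
  | base => rfl
  | succ m hle ih =>
    have hm := add_natCast_nonneg_iff.mpr hle
    rw [hf m hm, ih hm]

namespace IsNormalizedFamily

section

variable {E : (Fin n → ℤ) → MvPolynomial (Fin n) k}

theorem extValue_eq_pairing (hE : IsNormalizedFamily q t a E) (h : GenericTriple q t a)
    {v : Fin n → ℤ} {m : ℕ} (hm : 0 ≤ v + (m : Fin n → ℤ)) (u : Fin n → ℤ) :
    extValue q t a E m v u = pairing q t a E v u := by
  refine eq_minShift_of_succ_eq (f := fun m => extValue q t a E m v u) (fun m hm => ?_) hm
  rw [extValue, extValue, div_mul_eq_mul_div, div_mul_eq_mul_div,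
    div_eq_div_iff (h.polePoch_ne_zero _ u) (h.polePoch_ne_zero _ u),
    hE.polePoch_mul_eval h hm, polePoch_succ m (a • tilde q t u)]
  ring

theorem pairing_of_nonneg (hE : IsNormalizedFamily q t a E) (h : GenericTriple q t a)
    {v : Fin n → ℤ} (hv : 0 ≤ v) (u : Fin n → ℤ) :
    pairing q t a E v u = eval (a • tilde q t u) (E v) := by
  rw [← hE.extValue_eq_pairing (m := 0) h (by simpa using hv)]
  simp [extValue, polePoch_zero]

theorem pairing_shift (hE : IsNormalizedFamily q t a E) (h : GenericTriple q t a)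
    (v u : Fin n → ℤ) : poleFactor t (a • tilde q t (u - 1)) * pairing q t a E v u =
      poleFactor t (a • tilde q t v) * pairing q t a E (v + 1) (u - 1) := by
  have hm := add_natCast_nonneg_iff.mpr (le_refl (minShift v))
  generalize minShift v = m at hm
  have hm' : 0 ≤ v + ((m + 1 : ℕ) : Fin n → ℤ) := add_natCast_nonneg_iff.mpr
    ((add_natCast_nonneg_iff.mp hm).trans m.le_succ)
  have hv : v + ((m + 1 : ℕ) : Fin n → ℤ) = v + 1 + (m : Fin n → ℤ) := by
    push_cast
    ring
  rw [← hE.extValue_eq_pairing h hm', ← hE.extValue_eq_pairing (m := m) h (hv ▸ hm'), extValue,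
    extValue, polePoch_succ, ← smul_tilde_sub_natCast h.q_ne, add_sub_cancel_right,
    polePoch_succ' m (a • tilde q t u), ← smul_tilde_sub_one h.q_ne, hv, pow_succ,
    mul_smul, ← smul_tilde_sub_one h.q_ne]
  have := h.poleFactor_ne_zero (u - 1)
  have := h.polePoch_ne_zero m (u - 1)
  field_simp

theorem pairing_eq_div (hE : IsNormalizedFamily q t a E) (h : GenericTriple q t a)
    (v u : Fin n → ℤ) : pairing q t a E v u = poleFactor t (a • tilde q t v) /
      poleFactor t (a • tilde q t (u - 1)) * pairing q t a E (v + 1) (u - 1) := by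
  rw [div_mul_eq_mul_div, eq_div_iff (h.poleFactor_ne_zero _), ← hE.pairing_shift h, mul_comm]

theorem pairing_zero_left (hE : IsNormalizedFamily q t a E) (h : GenericTriple q t a)
    (u : Fin n → ℤ) : pairing q t a E 0 u = 1 := by
  obtain ⟨c, hc⟩ := exists_eq_C_of_mem_interpLine_zero (hE.mem_interpLine 0 le_rfl)
  have hone := hE.eval_smul_tau 0 le_rfl
  rw [hc, eval_C] at hone
  rw [pairing_of_nonneg hE h le_rfl, hc, eval_C, hone]

theorem pairing_hecke (hE : IsNormalizedFamily q t a E) (h : GenericTriple q t a)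
    {i j : Fin n} (hij : (j : ℕ) = i + 1) (v u : Fin n → ℤ) :
    (bar q t u j.rev - bar q t u i.rev) * ((t - 1) * bar q t v i * pairing q t a E v u +
      (bar q t v i - t * bar q t v j) * pairing q t a E (v ∘ Equiv.swap i j) u) =
    (bar q t v i - bar q t v j) * ((t - 1) * bar q t u j.rev * pairing q t a E v u +
      (bar q t u j.rev - t * bar q t u i.rev) *
        pairing q t a E v (u ∘ Equiv.swap j.rev i.rev)) := by
  induction v using shift_induction generalizing u with
  | nonneg v hv =>
    rw [hE.pairing_of_nonneg h hv, hE.pairing_of_nonneg h hv,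
      hE.pairing_of_nonneg (v := v ∘ Equiv.swap i j) h fun _ => hv _]
    exact hE.hecke_eval h hv u hij
  | shift v ih =>
    have hij' : (i.rev : ℕ) = j.rev + 1 := by
      simp only [Fin.val_rev]
      omega
    have hbar : bar q t (v + 1) = q • bar q t v := by simpa using bar_add_intCast h.q_ne v 1
    have hbar' : bar q t (u - 1) = q⁻¹ • bar q t u := by
      simpa [sub_eq_add_neg] using bar_add_intCast h.q_ne u (-1)
    have hq := h.q_ne
    have ih := ih (u - 1)
    simp only [hbar, hbar', Pi.smul_apply, smul_eq_mul] at ih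
    rw [hE.pairing_eq_div h v u, hE.pairing_eq_div h (v ∘ Equiv.swap i j),
      hE.pairing_eq_div h v (u ∘ Equiv.swap j.rev i.rev), poleFactor_smul_tilde_comp_swap hij,
      show u ∘ Equiv.swap j.rev i.rev - 1 = (u - 1) ∘ Equiv.swap j.rev i.rev from rfl,
      show v ∘ Equiv.swap i j + 1 = (v + 1) ∘ Equiv.swap i j from rfl,
      poleFactor_smul_tilde_comp_swap hij']
    field_simp at ih
    linear_combination poleFactor t (a • tilde q t v) / poleFactor t (a • tilde q t (u - 1)) * ih

end

variable {E : (Fin (n + 1) → ℤ) → MvPolynomial (Fin (n + 1)) k}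

theorem pairing_rot (hE : IsNormalizedFamily q t a E) (h : GenericTriple q t a)
    (v u : Fin (n + 1) → ℤ) : (1 - a * (bar q t v 0)⁻¹) * pairing q t a E (rot v) u =
      (1 - a * (bar q t u 0)⁻¹) * pairing q t a E v (rot u) := by
  induction v using shift_induction generalizing u with
  | nonneg v hv =>
    rw [hE.pairing_of_nonneg h hv, hE.pairing_of_nonneg h (rot_nonneg hv), hE.rot_eval h hv,
      pow_mul_smul_tilde_last h.t_ne, unrot_smul, unrot_tilde h.q_ne]
  | shift v ih =>
    have hbar : bar q t (v + 1) = q • bar q t v := by simpa using bar_add_intCast h.q_ne v 1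
    have hbar' : bar q t (u - 1) = q⁻¹ • bar q t u := by
      simpa [sub_eq_add_neg] using bar_add_intCast h.q_ne u (-1)
    have hrot : rot u - 1 = rot (u - 1) := by
      rw [sub_eq_iff_eq_add, ← rot_add_one, sub_add_cancel]
    have hv := poleFactor_smul_tilde_rot (a := a) h.q_ne h.t_ne v
    have hu := poleFactor_smul_tilde_rot (a := a) h.q_ne h.t_ne (u - 1)
    have ih := ih (u - 1)
    simp only [hbar, hbar', Pi.smul_apply, smul_eq_mul, mul_inv_cancel_left₀ h.q_ne] at hu ih
    rw [rot_add_one] at ih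
    have hP := hE.pairing_shift h (rot v) u
    have hQ := hE.pairing_shift h v (rot u)
    rw [hrot] at hQ
    apply mul_left_cancel₀ (h.poleFactor_ne_zero (u - 1))
    linear_combination (1 - a * (bar q t v 0)⁻¹) * hP + pairing q t a E (rot v + 1) (u - 1) * hv +
      poleFactor t (a • tilde q t v) * ih - (1 - a * (q⁻¹ * bar q t u 0)⁻¹) * hQ +
      pairing q t a E v (rot u) * hu

theorem pairing_rot_intCast (hE : IsNormalizedFamily q t a E) (h : GenericTriple q t a)
    (v : Fin (n + 1) → ℤ) (c : ℤ) :
    (1 - a * (bar q t v 0)⁻¹) * pairing q t a E (rot v) (c : Fin (n + 1) → ℤ) =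
      (1 - q ^ (-c) * a * (bar q t v 0)⁻¹) * pairing q t a E v (c : Fin (n + 1) → ℤ) := by
  induction v using shift_induction generalizing c with
  | nonneg v hv =>
    have htilde : a • tilde q t (c : Fin (n + 1) → ℤ) = (q ^ (-c) * a) • tau t (n + 1) := by
      rw [← zero_add (c : Fin (n + 1) → ℤ), smul_tilde_add_intCast h.q_ne, tilde_zero, smul_smul]
    rw [hE.pairing_of_nonneg h hv, hE.pairing_of_nonneg h (rot_nonneg hv), htilde]
    exact hE.rot_eval_smul_tau h hv (mul_ne_zero (zpow_ne_zero _ h.q_ne) h.a_ne)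
  | shift v ih =>
    have hbar : bar q t (v + 1) = q • bar q t v := by simpa using bar_add_intCast h.q_ne v 1
    have hv := poleFactor_smul_tilde_rot (a := a) h.q_ne h.t_ne v
    have hP := hE.pairing_shift h (rot v) (c : Fin (n + 1) → ℤ)
    have hQ := hE.pairing_shift h v (c : Fin (n + 1) → ℤ)
    have ih := ih (c - 1)
    rw [hbar, rot_add_one, Pi.smul_apply, smul_eq_mul, neg_sub, sub_eq_add_neg 1 c,
      zpow_add₀ h.q_ne, zpow_one, Int.cast_sub, Int.cast_one] at ih
    have hq : q * q ^ (-c) * a * (q * bar q t v 0)⁻¹ = q ^ (-c) * a * (bar q t v 0)⁻¹ := by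
      have := h.q_ne
      field_simp
    apply mul_left_cancel₀ (h.poleFactor_ne_zero (c - 1))
    linear_combination (1 - a * (bar q t v 0)⁻¹) * hP +
      pairing q t a E (rot v + 1) (c - 1) * hv + poleFactor t (a • tilde q t v) * ih -
      (1 - q ^ (-c) * a * (bar q t v 0)⁻¹) * hQ -
      poleFactor t (a • tilde q t v) * pairing q t a E (v + 1) (c - 1) * hq

theorem pairing_zero_right (hE : IsNormalizedFamily q t a E) (h : GenericTriple q t a)
    (v : Fin (n + 1) → ℤ) : pairing q t a E v 0 = 1 := by
  refine int_induction (P := fun v => pairing q t a E v 0 = 1) (hE.pairing_zero_left h 0)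
    (fun v i j hij hvij ih => ?swap) (fun v => ?rotate) v
  case swap =>
    have hecke := hE.pairing_hecke h hij v 0
    have hij' : (i.rev : ℕ) = j.rev + 1 := by
      simp only [Fin.val_rev]
      omega
    rw [bar_of_eq h.t_ne hij' rfl, ih] at hecke
    apply mul_left_cancel₀ (h.bar_sub_mul_bar_ne_zero hvij)
    apply mul_left_cancel₀ (mul_ne_zero (sub_ne_zero.mpr h.t_ne_one)
      (bar_ne_zero h.q_ne h.t_ne 0 i.rev))
    linear_combination hecke
  case rotate =>
    have hrot := hE.pairing_rot_intCast h v 0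
    simp only [Int.cast_zero, neg_zero, zpow_zero, one_mul] at hrot
    rw [mul_left_cancel₀ (h.one_sub_bar_inv_ne_zero v 0) hrot]

theorem pairing_comm_succ (hE : IsNormalizedFamily q t a E) (h : GenericTriple q t a)
    (v u : Fin (n + 1) → ℤ) : pairing q t a E v u = pairing q t a E u v := by
  refine int_induction (P := fun v => ∀ u, pairing q t a E v u = pairing q t a E u v) ?zero
    (fun v i j hij hvij ih u => ?swap) (fun v => ⟨fun ih u => ?unrotate, fun ih u => ?rotate⟩) v u
  case zero => exact fun u => by rw [hE.pairing_zero_left h, hE.pairing_zero_right h]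
  case swap =>
    have hij' : (i.rev : ℕ) = j.rev + 1 := by
      simp only [Fin.val_rev]
      omega
    have hvu := hE.pairing_hecke h hij v u
    have huv := hE.pairing_hecke h hij' u v
    rw [Fin.rev_rev, Fin.rev_rev, ← ih, ← ih] at huv
    apply mul_left_cancel₀ (mul_ne_zero (h.bar_sub_ne_zero h.t_ne_one u hij')
      (h.bar_sub_mul_bar_ne_zero hvij))
    linear_combination hvu + huv
  case unrotate =>
    obtain ⟨u, rfl⟩ := rot_surjective u
    apply mul_left_cancel₀ (h.one_sub_bar_inv_ne_zero u 0)
    rw [← hE.pairing_rot h v u, ih, ← hE.pairing_rot h u v]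
  case rotate =>
    apply mul_left_cancel₀ (h.one_sub_bar_inv_ne_zero v 0)
    rw [hE.pairing_rot h v u, ih, hE.pairing_rot h u v]

end IsNormalizedFamily

theorem IsNormalizedFamily.pairing_comm {E : (Fin n → ℤ) → MvPolynomial (Fin n) k}
    (hE : IsNormalizedFamily q t a E) (h : GenericTriple q t a) (v u : Fin n → ℤ) :
    pairing q t a E v u = pairing q t a E u v := by
  cases n with
  | zero => rw [Subsingleton.elim v u]
  | succ n => exact hE.pairing_comm_succ h v u

theorem IsNormalizedFamily.pairing_zero {E : (Fin n → ℤ) → MvPolynomial (Fin n) k}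
    (hE : IsNormalizedFamily q t a E) (h : GenericTriple q t a) (v : Fin n → ℤ) :
    pairing q t a E v 0 = 1 := by
  rw [hE.pairing_comm h, hE.pairing_zero_left h]

end Shift

/-! ### Rational functions -/

section RationalFunctions

variable {k l : Type*} [Field k] [Field l] {n : ℕ}

theorem ofPoly_injective : Function.Injective (ofPoly (n := n) (k := k)) :=
  IsFractionRing.injective _ _

theorem ofPoly_ne_zero {f : MvPolynomial (Fin n) k} (hf : f ≠ 0) : ofPoly f ≠ 0 :=
  (map_ne_zero_iff ofPoly ofPoly_injective).mpr hf

theorem HasValueAt.C_mul {f : RatFun n k} {y : Fin n → k} {c : k} (h : HasValueAt f y c) (r : k) :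
    HasValueAt (ofPoly (C r) * f) y (r * c) := by
  obtain ⟨p, d, hd, rfl, rfl⟩ := h
  refine ⟨C r * p, d, hd, ?_, ?_⟩
  · rw [map_mul, mul_div_assoc]
  · rw [map_mul, eval_C, mul_div_assoc]

theorem eval_dilate (c : k) (f : MvPolynomial (Fin n) k) (x : Fin n → k) :
    eval x (dilate c f) = eval (c • x) f :=
  eval_scaleVars (fun _ => c) f x

theorem map_dilate (φ : k →+* l) (c : k) (f : MvPolynomial (Fin n) k) :
    map φ (dilate c f) = dilate (φ c) (map φ f) := by
  simp only [dilate, map_bind₁, map_mul, map_C, map_X]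

theorem dilate_C_mul (c r : k) (f : MvPolynomial (Fin n) k) :
    dilate c (C r * f) = C r * dilate c f := by
  rw [dilate, dilate, map_mul, algHom_C, algebraMap_eq]

/-- The denominator `polePoch q t m` as a polynomial. -/
def poleDenom (q t : k) (n m : ℕ) : MvPolynomial (Fin n) k :=
  ∏ i, ∏ j ∈ Finset.range m, (1 - C (q ^ j * (q * t ^ ((n : ℤ) - 1))) * X i)

variable {q t : k}

theorem eval_poleDenom (m : ℕ) (x : Fin n → k) :
    eval x (poleDenom q t n m) = polePoch q t m x := by
  simp only [poleDenom, polePoch, qPoch, map_prod, map_sub, map_mul, map_one, eval_C, eval_X,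
    mul_assoc]

theorem poleDenom_ne_zero (m : ℕ) : poleDenom q t n m ≠ 0 := by
  intro h
  have heval := eval_poleDenom (q := q) (t := t) m (0 : Fin n → k)
  simp [h, polePoch, qPoch] at heval

theorem ofPoly_poleDenom (m : ℕ) : ofPoly (poleDenom q t n m) =
    ∏ i, qPoch (ofPoly (C q)) (ofPoly (C (q * t ^ ((n : ℤ) - 1)) * X i)) m := by
  simp only [poleDenom, qPoch, map_prod, map_sub, map_one, map_mul, map_pow,
    mul_assoc]

theorem map_poleDenom (φ : k →+* l) (m : ℕ) :
    map φ (poleDenom q t n m) = poleDenom (φ q) (φ t) n m := by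
  simp only [poleDenom, map_prod, map_sub, map_one, map_mul, map_C, map_X, map_pow, map_zpow₀]

/-- The rational function `c f(q ^ m x) / ∏ (q t ^ (n - 1) x_i; q)_m`, the common shape of `G_v` and
`K_v`. -/
def shiftFrac (q t c : k) (m : ℕ) (f : MvPolynomial (Fin n) k) : RatFun n k :=
  ofPoly (C c * dilate (q ^ m) f) / ofPoly (poleDenom q t n m)

theorem shiftFrac_mul (c r : k) (m : ℕ) (f : MvPolynomial (Fin n) k) :
    shiftFrac q t (r * c) m f = ofPoly (C r) * shiftFrac q t c m f := by
  rw [shiftFrac, shiftFrac, C_mul, mul_assoc, map_mul, mul_div_assoc]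

theorem shiftFrac_C_mul (c r : k) (m : ℕ) (f : MvPolynomial (Fin n) k) :
    shiftFrac q t c m (C r * f) = shiftFrac q t (c * r) m f := by
  rw [shiftFrac, shiftFrac, dilate_C_mul, C_mul, mul_assoc]

theorem hasValueAt_shiftFrac (c : k) {m : ℕ} (f : MvPolynomial (Fin n) k) {y : Fin n → k}
    (hy : polePoch q t m y ≠ 0) :
    HasValueAt (shiftFrac q t c m f) y (c / polePoch q t m y * eval (q ^ m • y) f) := by
  refine ⟨C c * dilate (q ^ m) f, poleDenom q t n m, by rwa [eval_poleDenom], rfl, ?_⟩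
  rw [map_mul, eval_C, eval_dilate, eval_poleDenom, div_mul_eq_mul_div]

theorem shiftFrac_succ_eq [Infinite k] {c c' : k} {m : ℕ} {f f' : MvPolynomial (Fin n) k}
    (h : ∀ x, c' * eval (q ^ (m + 1) • x) f' =
      c * eval (q ^ m • x) f * poleFactor t (q ^ (m + 1) • x)) :
    shiftFrac q t c' (m + 1) f' = shiftFrac q t c m f := by
  rw [shiftFrac, shiftFrac, div_eq_div_iff (ofPoly_ne_zero (poleDenom_ne_zero _))
    (ofPoly_ne_zero (poleDenom_ne_zero _)), ← map_mul, ← map_mul]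
  refine congrArg ofPoly (MvPolynomial.funext fun x => ?_)
  simp only [map_mul, eval_C, eval_dilate, eval_poleDenom]
  rw [h, polePoch_succ]
  ring

end RationalFunctions

section BaseChange

variable {n : ℕ}

theorem inclRat_ofPoly (f : MvPolynomial (Fin n) BaseF) :
    inclRat n (ofPoly f) = ofPoly (map inclFK f) :=
  IsFractionRing.lift_algebraMap _ f

theorem inclRat_shiftFrac (q t c : BaseF) (m : ℕ) (f : MvPolynomial (Fin n) BaseF) :
    inclRat n (shiftFrac q t c m f) =
      shiftFrac (inclFK q) (inclFK t) (inclFK c) m (map inclFK f) := by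
  rw [shiftFrac, shiftFrac, map_div₀, inclRat_ofPoly, inclRat_ofPoly, map_poleDenom, map_mul, map_C,
    map_dilate, map_pow]

theorem aK_ne_inclFK (c : BaseF) : aK ≠ inclFK c := by
  intro h
  rw [aK, inclFK, ← RatFunc.algebraMap_X, ← RatFunc.algebraMap_C] at h
  exact Polynomial.X_ne_C c (RatFunc.algebraMap_injective BaseF h)

theorem genericTriple : GenericTriple qK tK aK where
  q_ne := (map_ne_zero inclFK).mpr qF_ne_zero
  t_ne := (map_ne_zero inclFK).mpr tF_ne_zero
  pow_ne m b hm h := by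
    rw [qK, tK, ← map_zpow₀, ← map_zpow₀] at h
    exact generic_qF_tF.pow_ne m b hm (inclFK.injective h)
  t_ne_one h := by
    rw [tK, ← map_one inclFK] at h
    simpa using (qF_zpow_mul_tF_zpow_eq_one (a := 0) (b := 1) (by simp [inclFK.injective h])).2
  a_ne h := aK_ne_inclFK 0 (by rw [h, map_zero])
  a_mul_ne m b h := by
    rw [qK, tK, ← map_zpow₀, ← map_zpow₀, ← map_mul] at h
    apply aK_ne_inclFK (qF ^ m * tF ^ b)⁻¹
    rw [map_inv₀]
    exact eq_inv_of_mul_eq_one_left h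

theorem map_mem_interpLine {k l : Type*} [Field k] [Field l] (φ : k →+* l) {q t : k}
    {v : Fin n → ℤ} {f : MvPolynomial (Fin n) k} (hf : f ∈ interpLine q t v) :
    map φ f ∈ interpLine (φ q) (φ t) v := by
  refine ⟨(Finset.sup_mono (support_map_subset φ f)).trans hf.1, fun w hw hd hne => ?_⟩
  have hbar : bar (φ q) (φ t) w = φ ∘ bar q t w := by
    funext i
    simp only [bar, Function.comp_apply, map_mul, map_zpow₀]
  rw [hbar, eval_map]
  exact (eval₂_comp φ _ f).symm.trans (by rw [hf.2 w hw hd hne, map_zero])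

/-- The polynomial `G_v`, indexed by integral vectors; only nonnegative `v` are meaningful. -/
def compG (v : Fin n → ℤ) : MvPolynomial (Fin n) BaseF :=
  polyG fun i => (v i).toNat

/-- The polynomial `K_v`, indexed by integral vectors; only nonnegative `v` are meaningful. -/
def compK (v : Fin n → ℤ) : MvPolynomial (Fin n) BaseK :=
  polyK fun i => (v i).toNat

theorem compG_mem_interpLine {v : Fin n → ℤ} (hv : 0 ≤ v) : compG v ∈ interpLine qF tF v := by
  lift v to Fin n → ℕ using hv
  exact (isInterp_iff_mem_interpLine.mp (isInterp_polyG v)).1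

theorem coeff_compG (v : Fin n → ℤ) :
    coeff (Finsupp.equivFunOnFinite.symm fun i => (v i).toNat) (compG v) = 1 :=
  (isInterp_polyG _).2.2

theorem compG_ne_zero (v : Fin n → ℤ) : compG v ≠ 0 := fun h => by
  simpa [h] using coeff_compG v

theorem eval_smul_tau_compG_ne_zero {v : Fin n → ℤ} (hv : 0 ≤ v) :
    eval (aK • tau tK n) (map inclFK (compG v)) ≠ 0 :=
  eval_smul_tau_ne_zero genericTriple (g := fun v => map inclFK (compG v))
    (fun _ hv => map_mem_interpLine inclFK (compG_mem_interpLine hv))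
    (fun v _ => (map_ne_zero_iff _ (map_injective _ inclFK.injective)).mpr (compG_ne_zero v)) hv

theorem compK_eq (v : Fin n → ℤ) :
    compK v = C (eval (aK • tau tK n) (map inclFK (compG v)))⁻¹ * map inclFK (compG v) :=
  rfl

theorem isNormalizedFamily_compK : IsNormalizedFamily qK tK aK (compK (n := n)) where
  mem_interpLine v hv := by
    rw [compK_eq, ← smul_eq_C_mul]
    exact Submodule.smul_mem _ _ (map_mem_interpLine inclFK (compG_mem_interpLine hv))
  eval_smul_tau v hv := by
    rw [compK_eq, map_mul, eval_C, inv_mul_cancel₀ (eval_smul_tau_compG_ne_zero hv)]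

theorem prod_qPoch_eq_polePoch {k : Type*} [Field k] {q t : k} (hq : q ≠ 0) (ht : t ≠ 0) (a : k)
    (m : ℕ) (v : Fin n → ℤ) :
    ∏ i, qPoch q (q ^ (1 - (m : ℤ)) * a * (bar q t v i)⁻¹) m =
      polePoch q t m (a • tilde q t (v + (m : Fin n → ℤ))) := by
  rw [← Equiv.prod_comp Fin.revPerm, polePoch]
  refine Finset.prod_congr rfl fun i _ => ?_
  have hv := smul_tilde_add_intCast (t := t) (a := a) hq v m
  rw [Int.cast_natCast] at hv
  rw [hv, Pi.smul_apply, Pi.smul_apply, smul_eq_mul, smul_eq_mul, tilde_eq ht, sub_eq_add_neg 1,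
    zpow_add₀ hq, zpow_one, ← neg_sub (n : ℤ) 1, zpow_neg t]
  have := zpow_ne_zero ((n : ℤ) - 1) ht
  congr 1
  simp only [Fin.revPerm_apply]
  field_simp

theorem shiftK_eq (m : ℕ) (v : Fin n → ℤ) :
    shiftK m v = shiftFrac qK tK (polePoch qK tK m (aK • tilde qK tK (v + (m : Fin n → ℤ)))) m
      (compK (v + (m : Fin n → ℤ))) := by
  rw [shiftK, ratA, Finset.prod_div_distrib, ← ofPoly_poleDenom, ← map_prod, ← map_prod,
    prod_qPoch_eq_polePoch genericTriple.q_ne genericTriple.t_ne, shiftFrac, map_mul,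
    mul_div_right_comm]
  rfl

theorem pow_mul_qPoch_mul_inv {k : Type*} [Field k] {q b x : k} (hq : q ≠ 0) (hb : b ≠ 0)
    (hx : x ≠ 0) (m : ℕ) : x ^ m * qPoch q (q ^ (-(m : ℤ)) * b * x⁻¹) m =
      (∏ j ∈ Finset.range m, -(q ^ (-(j + 1 : ℤ)) * b)) * qPoch q (q * b⁻¹ * x) m := by
  induction m with
  | zero => simp [qPoch]
  | succ m ih =>
    have hm : q * (q ^ (-((m + 1 : ℕ) : ℤ)) * b * x⁻¹) = q ^ (-(m : ℤ)) * b * x⁻¹ := by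
      rw [Nat.cast_add_one, neg_add, zpow_add₀ hq, zpow_neg_one]
      field_simp
    rw [qPoch_succ', hm, Finset.prod_range_succ, qPoch_succ, Nat.cast_add_one, pow_succ]
    have hfactor : x * (1 - q ^ (-(m + 1 : ℤ)) * b * x⁻¹) =
        -(q ^ (-(m + 1 : ℤ)) * b) * (1 - q ^ m * (q * b⁻¹ * x)) := by
      rw [zpow_neg, ← Nat.cast_add_one, zpow_natCast, pow_succ]
      field_simp
      ring
    linear_combination (x * (1 - q ^ (-(m + 1 : ℤ)) * b * x⁻¹)) * ih +
      (∏ j ∈ Finset.range m, -(q ^ (-(j + 1 : ℤ)) * b)) * qPoch q (q * b⁻¹ * x) m * hfactor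

end BaseChange

section IntegralVectors

variable {n : ℕ}

theorem prod_X_pow_mul_qPoch {k : Type*} [Field k] {q t : k} (hq : q ≠ 0) (ht : t ≠ 0) (m : ℕ) :
    ∏ i : Fin n, (ofPoly (X i) ^ m * qPoch (ofPoly (C q))
      (ofPoly (C (q ^ (-(m : ℤ)) * t ^ (1 - (n : ℤ)))) * (ofPoly (X i))⁻¹) m) =
      ofPoly (C (∏ j ∈ Finset.range m, (-(q ^ (-(j + 1 : ℤ)) * t ^ (1 - (n : ℤ)))) ^ n)) *
        ofPoly (poleDenom q t n m) := by
  set φ : k →+* RatFun n k := ofPoly.comp C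
  have hC (c : k) : ofPoly (C c) = φ c := rfl
  have hb : φ q * (φ (t ^ (1 - (n : ℤ))))⁻¹ = φ (q * t ^ ((n : ℤ) - 1)) := by
    rw [← map_inv₀, ← map_mul, ← zpow_neg, neg_sub]
  simp only [ofPoly_poleDenom, map_mul ofPoly, hC, map_mul φ, map_zpow₀ φ q (-(m : ℤ))]
  rw [Finset.prod_congr rfl fun i _ => pow_mul_qPoch_mul_inv ((map_ne_zero φ).mpr hq)
    ((map_ne_zero φ).mpr (zpow_ne_zero _ ht)) (ofPoly_ne_zero (X_ne_zero i)) m,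
    Finset.prod_mul_distrib, Finset.prod_const, Finset.card_univ, Fintype.card_fin, hb, map_mul φ,
    Finset.prod_pow, map_pow, map_prod]
  simp only [map_neg, map_mul, map_zpow₀]

/-- The scalar by which `G_v`, computed with the shift `v + (m ^ n)`, differs from
`G_{v + (m ^ n)}(q ^ m x) / ∏ (q t ^ (n - 1) x_i; q)_m`. -/
def scalarG {k : Type*} [Field k] (q t : k) (m : ℕ) (v : Fin n → ℤ) : k :=
  q ^ (-(m : ℤ) * (∑ i, v i) - (m : ℤ) ^ 2 * n) /
    ∏ j ∈ Finset.range m, (-(q ^ (-(j + 1 : ℤ)) * t ^ (1 - (n : ℤ)))) ^ n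

theorem scalarG_ne_zero {k : Type*} [Field k] {q t : k} (hq : q ≠ 0) (ht : t ≠ 0) (m : ℕ)
    (v : Fin n → ℤ) : scalarG q t m v ≠ 0 :=
  div_ne_zero (zpow_ne_zero _ hq) <| Finset.prod_ne_zero_iff.mpr fun _ _ =>
    pow_ne_zero n (neg_ne_zero.mpr (mul_ne_zero (zpow_ne_zero _ hq) (zpow_ne_zero _ ht)))

theorem scalarG_succ_mul {k : Type*} [Field k] {q t : k} (hq : q ≠ 0) (ht : t ≠ 0) (m : ℕ)
    (v : Fin n → ℤ) : scalarG q t (m + 1) v * (-t ^ (1 - (n : ℤ))) ^ n =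
      scalarG q t m v * q ^ (-∑ i, (v + (m : Fin n → ℤ)) i) := by
  have hexp : -((m + 1 : ℕ) : ℤ) * ∑ i, v i - ((m + 1 : ℕ) : ℤ) ^ 2 * n =
      (-(m : ℤ) * (∑ i, v i) - (m : ℤ) ^ 2 * n) +
        (-∑ i, (v + (m : Fin n → ℤ)) i + -(m + 1 : ℤ) * n) := by
    simp only [Pi.add_apply, Pi.natCast_apply, Finset.sum_add_distrib, Finset.sum_const,
      Finset.card_univ, Fintype.card_fin, nsmul_eq_mul]
    push_cast
    ring
  have hpow : (-(q ^ (-(m + 1 : ℤ)) * t ^ (1 - (n : ℤ)))) ^ n =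
      q ^ (-(m + 1 : ℤ) * n) * (-t ^ (1 - (n : ℤ))) ^ n := by
    rw [← mul_neg, mul_pow, zpow_mul, zpow_natCast]
  have := zpow_ne_zero (1 - (n : ℤ)) ht
  have := zpow_ne_zero (-(m + 1 : ℤ) * n) hq
  rw [scalarG, scalarG, hexp, zpow_add₀ hq, zpow_add₀ hq, Finset.prod_range_succ, hpow]
  generalize ∏ j ∈ Finset.range m, (-(q ^ (-(j + 1 : ℤ)) * t ^ (1 - (n : ℤ)))) ^ n = M
  field_simp

theorem shiftG_eq (m : ℕ) (v : Fin n → ℤ) :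
    shiftG m v = shiftFrac qF tF (scalarG qF tF m v) m (compG (v + (m : Fin n → ℤ))) := by
  have hdiv (c d : BaseF) : ofPoly (C (c / d)) = ofPoly (C c) / ofPoly (C (σ := Fin n) d) :=
    map_div₀ (ofPoly.comp C) c d
  rw [shiftG, prod_X_pow_mul_qPoch qF_ne_zero tF_ne_zero, shiftFrac, scalarG, map_mul, map_mul,
    hdiv, div_mul_eq_mul_div, div_div]
  rfl

theorem coeff_raise {k : Type*} [Field k] (q t : k) {f : MvPolynomial (Fin (n + 1)) k}
    {s : Fin (n + 1) →₀ ℕ} (hf : f.totalDegree ≤ s.degree) :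
    coeff (Finsupp.single (Fin.last n) 1 + s.mapDomain (finRotate (n + 1)).symm) (raise q t f) =
      q⁻¹ ^ s 0 * coeff s f := by
  have hdeg : (unrotPoly q f).totalDegree < (Finsupp.single (Fin.last n) 1 +
      s.mapDomain (finRotate (n + 1)).symm).degree := by
    rw [map_add, Finsupp.degree_single, Finsupp.degree_mapDomain]
    have := totalDegree_unrotPoly_le (q := q) f
    omega
  have hprod : (s.prod fun i e => (Pi.mulSingle 0 q⁻¹ : Fin (n + 1) → k) i ^ e) = q⁻¹ ^ s 0 := by
    rw [Finsupp.prod_fintype _ _ fun _ => pow_zero _,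
      Finset.prod_eq_single_of_mem 0 (Finset.mem_univ 0) fun i _ hi => by simp [hi],
      Pi.mulSingle_eq_same]
  rw [raise, sub_mul, coeff_sub, coeff_C_mul, coeff_eq_zero_of_totalDegree_lt hdeg, coeff_X_mul,
    unrotPoly, coeff_rename_mapDomain _ (finRotate (n + 1)).symm.injective, coeff_scaleVars, hprod,
    mul_zero, sub_zero]

theorem equivFunOnFinite_symm_rot {v : Fin (n + 1) → ℤ} (hv : 0 ≤ v) :
    (Finsupp.equivFunOnFinite.symm fun i => (rot v i).toNat) =
      Finsupp.single (Fin.last n) 1 + (Finsupp.equivFunOnFinite.symm fun i =>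
        (v i).toNat).mapDomain (finRotate (n + 1)).symm := by
  ext i
  rw [Finsupp.add_apply, Finsupp.mapDomain_equiv_apply, Equiv.symm_symm]
  simp only [Finsupp.coe_equivFunOnFinite_symm]
  refine Fin.lastCases ?_ (fun i => ?_) i
  · have : 0 ≤ v 0 := hv 0
    rw [rot_last, finRotate_last, Finsupp.single_eq_same]
    omega
  · rw [rot_castSucc, finRotate_apply, Fin.coeSucc_eq_succ,
      Finsupp.single_eq_of_ne (Fin.castSucc_lt_last i).ne, zero_add]

theorem raise_compG {v : Fin (n + 1) → ℤ} (hv : 0 ≤ v) :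
    raise qF tF (compG v) = qF ^ (-v 0) • compG (rot v) := by
  obtain ⟨c, hc⟩ := exists_eq_smul generic_qF_tF (rot_nonneg hv)
    (raise_mem_interpLine qF_ne_zero hv (compG_mem_interpLine hv))
    (compG_mem_interpLine (rot_nonneg hv)) (compG_ne_zero _)
  have hcoeff := coeff_raise qF tF (f := compG v)
    (s := Finsupp.equivFunOnFinite.symm fun i => (v i).toNat)
    (by rw [Finsupp.degree_eq_sum]; exact (isInterp_polyG _).1)
  rw [← equivFunOnFinite_symm_rot hv, hc, coeff_smul, coeff_compG, coeff_compG, smul_eq_mul,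
    mul_one, mul_one, Finsupp.coe_equivFunOnFinite_symm, inv_pow, ← zpow_natCast, ← zpow_neg,
    Int.toNat_of_nonneg (hv 0)] at hcoeff
  rw [hc, hcoeff]

theorem prod_zpow_eq_zpow_sum {ι k : Type*} [Field k] {q : k} (hq : q ≠ 0) (s : Finset ι)
    (f : ι → ℤ) : ∏ i ∈ s, q ^ f i = q ^ ∑ i ∈ s, f i := by
  induction s using Finset.cons_induction with
  | empty => simp
  | cons i s hi ih => rw [Finset.prod_cons, Finset.sum_cons, zpow_add₀ hq, ih]

theorem eval_compG_add_one {v : Fin n → ℤ} (hv : 0 ≤ v) (x : Fin n → BaseF) :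
    qF ^ (-∑ i, v i) * eval x (compG (v + 1)) =
      (-tF ^ (1 - (n : ℤ))) ^ n * poleFactor tF x * eval (qF⁻¹ • x) (compG v) := by
  cases n with
  | zero => simp [poleFactor, Subsingleton.elim (v + 1) v, Subsingleton.elim (qF⁻¹ • x) x]
  | succ n =>
    have hfactor (y : BaseF) : y - tF ^ (-(n : ℤ)) = -tF ^ (-(n : ℤ)) * (1 - tF ^ (n : ℤ) * y) := by
      rw [neg_mul, mul_sub, ← mul_assoc, ← zpow_add₀ tF_ne_zero, neg_add_cancel, zpow_zero]
      ring
    have hprod := prod_mul_add_one (q := qF) (H := fun v x => eval x (compG v))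
      (c := fun v => qF ^ (-v 0)) (d := fun y => y - tF ^ (-(n : ℤ)))
      (fun v hv x => by rw [← smul_eval, ← raise_compG hv, eval_raise]) hv x
    simp only [iterate_apply_zero_of_castSucc (F := fun v => v) rot_castSucc, hfactor,
      Finset.prod_mul_distrib, Finset.prod_const, Finset.card_univ, Fintype.card_fin] at hprod
    rw [← Finset.sum_neg_distrib, ← prod_zpow_eq_zpow_sum qF_ne_zero, hprod]
    simp only [poleFactor, Nat.cast_add_one, sub_add_cancel_right, add_sub_cancel_right]

theorem shiftG_succ {v : Fin n → ℤ} {m : ℕ} (hm : 0 ≤ v + (m : Fin n → ℤ)) :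
    shiftG (m + 1) v = shiftG m v := by
  have := generic_qF_tF.infinite
  rw [shiftG_eq, shiftG_eq]
  refine shiftFrac_succ_eq fun x => ?_
  have hstep := eval_compG_add_one hm (qF ^ (m + 1) • x)
  have hscalar := scalarG_succ_mul qF_ne_zero tF_ne_zero m v
  rw [smul_smul, pow_succ', inv_mul_cancel_left₀ qF_ne_zero, ← pow_succ'] at hstep
  have hq := zpow_ne_zero (-∑ i, (v + (m : Fin n → ℤ)) i) qF_ne_zero
  apply mul_left_cancel₀ hq
  rw [Nat.cast_add_one, ← add_assoc]
  linear_combination scalarG qF tF (m + 1) v * hstep +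
    poleFactor tF (qF ^ (m + 1) • x) * eval (qF ^ m • x) (compG (v + (m : Fin n → ℤ))) * hscalar

theorem shiftK_succ {v : Fin n → ℤ} {m : ℕ} (hm : 0 ≤ v + (m : Fin n → ℤ)) :
    shiftK (m + 1) v = shiftK m v := by
  have := genericTriple.toGeneric.infinite
  rw [shiftK_eq, shiftK_eq]
  exact shiftFrac_succ_eq (isNormalizedFamily_compK.polePoch_mul_eval genericTriple hm)

theorem shiftG_eq_ratG {v : Fin n → ℤ} {m : ℕ} (hm : 0 ≤ v + (m : Fin n → ℤ)) :
    shiftG m v = ratG v :=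
  eq_minShift_of_succ_eq (f := fun m => shiftG m v) (fun _ => shiftG_succ) hm

theorem shiftK_eq_ratK {v : Fin n → ℤ} {m : ℕ} (hm : 0 ≤ v + (m : Fin n → ℤ)) :
    shiftK m v = ratK v :=
  eq_minShift_of_succ_eq (f := fun m => shiftK m v) (fun _ => shiftK_succ) hm

theorem hasValueAt_ratK (v u : Fin n → ℤ) :
    HasValueAt (ratK v) (aK • tilde qK tK u) (pairing qK tK aK compK v u) := by
  rw [ratK, shiftK_eq]
  exact hasValueAt_shiftFrac _ _ (genericTriple.polePoch_ne_zero _ u)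

theorem exists_inclRat_ratG_eq (v : Fin n → ℤ) :
    ∃ c : BaseK, c ≠ 0 ∧ inclRat n (ratG v) = ofPoly (C c) * ratK v := by
  have hv : 0 ≤ v + (minShift v : Fin n → ℤ) := add_natCast_nonneg_iff.mpr le_rfl
  have hvalue := eval_smul_tau_compG_ne_zero hv
  have hpole := genericTriple.polePoch_ne_zero (minShift v) (v + (minShift v : Fin n → ℤ))
  have hscalar : inclFK (scalarG qF tF (minShift v) v) ≠ 0 :=
    (map_ne_zero inclFK).mpr (scalarG_ne_zero qF_ne_zero tF_ne_zero _ v)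
  refine ⟨_, div_ne_zero (mul_ne_zero hscalar hvalue) hpole, ?_⟩
  rw [ratG, ratK, shiftG_eq, shiftK_eq, inclRat_shiftFrac, compK_eq, shiftFrac_C_mul,
    ← shiftFrac_mul, ← mul_assoc, div_mul_cancel₀ _ hpole, mul_inv_cancel_right₀ hvalue]
  rfl

theorem exists_hasValueAt_ratG (v : Fin n → ℤ) :
    ∃ c : BaseK, c ≠ 0 ∧ HasValueAt (inclRat n (ratG v)) (aK • tau tK n) c ∧
      ratK v = inclRat n (ratG v) / ofPoly (C c) := by
  obtain ⟨c, hc, hG⟩ := exists_inclRat_ratG_eq v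
  refine ⟨c, hc, ?_, ?_⟩
  · have h := (hasValueAt_ratK v 0).C_mul c
    rwa [isNormalizedFamily_compK.pairing_zero genericTriple, mul_one, tilde_zero, ← hG] at h
  · rw [hG, mul_div_cancel_left₀ _ (ofPoly_ne_zero (C_ne_zero.mpr hc))]

end IntegralVectors

end InterpMac

end

theorem theoremB (n : ℕ) :
    -- for compositions, the defining conditions determine exactly one polynomial, `G_α`
    (∀ (α : Fin n → ℕ) (P : MvPolynomial (Fin n) InterpMac.BaseF),
      InterpMac.IsInterp InterpMac.qF InterpMac.tF α P ↔ P = InterpMac.polyG α) ∧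
    -- `G_v` and `K_v` do not depend on the choice of `m` with `v + (m ^ n)` a composition
    (∀ (v : Fin n → ℤ) (m : ℕ), (∀ i, 0 ≤ v i + m) →
      InterpMac.shiftG m v = InterpMac.ratG v ∧ InterpMac.shiftK m v = InterpMac.ratK v) ∧
    -- `K_v = G_v / G_v(a τ)`, where `G_v(a τ)` is defined and not zero
    (∀ v : Fin n → ℤ, ∃ c : InterpMac.BaseK, c ≠ 0 ∧
      InterpMac.HasValueAt (InterpMac.inclRat n (InterpMac.ratG v))
        (fun i => InterpMac.aK * InterpMac.tau InterpMac.tK n i) c ∧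
      InterpMac.ratK v =
        InterpMac.inclRat n (InterpMac.ratG v) / InterpMac.ofPoly (MvPolynomial.C c)) ∧
    -- duality `K_u(a ṽ) = K_v(a ũ)`, where both sides are defined
    (∀ u v : Fin n → ℤ, ∃ c : InterpMac.BaseK,
      InterpMac.HasValueAt (InterpMac.ratK u)
        (fun i => InterpMac.aK * InterpMac.tilde InterpMac.qK InterpMac.tK v i) c ∧
      InterpMac.HasValueAt (InterpMac.ratK v)
        (fun i => InterpMac.aK * InterpMac.tilde InterpMac.qK InterpMac.tK u i) c) := by
  refine ⟨InterpMac.isInterp_iff, fun v m hm => ?_, InterpMac.exists_hasValueAt_ratG,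
    fun u v => ?_⟩
  · exact ⟨InterpMac.shiftG_eq_ratG hm, InterpMac.shiftK_eq_ratK hm⟩
  · have hsymm := InterpMac.isNormalizedFamily_compK.pairing_comm InterpMac.genericTriple u v
    exact ⟨_, InterpMac.hasValueAt_ratK u v, hsymm ▸ InterpMac.hasValueAt_ratK v u⟩
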